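/- Let $K$ be a field and let $Q=(Q_0,Q_1)$ be a finite tree, i.e. a finite quiver whose underlying undirected graph is a tree. A vertex is branching if two distinct arrows start in it or two distinct arrows end in it. A left arm of $Q$ is a linearly oriented subquiver $a_1\to a_2\to\dots\to a_n$ ($n\ge 1$), all of whose vertices are non-branching in $Q$, such that $a_1$ is a source of $Q$ and $a_n$ is an immediate predecessor of a branching vertex; a right arm is a linearly oriented subquiver $c_1\to c_2\to\dots\to c_n$ ($n\ge1$), all of whose vertices are non-branching in $Q$, such that $c_1$ is an immediate successor of a branching vertex and $c_n$ is a sink of $Q$. An arm is non-trivial if $n\ge 2$. Assume that $Q$ has at least one non-trivial arm (so $Q$ is not itself linearly oriented), and let $Q'$ be the armless subtree of $Q$, i.e. the full subquiver obtained by shortening each arm to a trivial one: from every left arm all vertices but $a_n$ are removed, and from every right arm all vertices but $c_1$. A zero relation on a quiver is a path of length at least two. Let $R$ and $R'$ be sets of zero relations on $Q$ and $Q'$ respectively, let $S'$ be the set of all zero relations on $Q'$ (paths of $Q'$ are regarded as paths of $Q$), and let $B=KQ/\langle R\rangle$ and $B'=KQ'/\langle R'\rangle$ be the corresponding bound quiver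 algebras. For a finite-dimensional algebra $A$, let $\operatorname{dom.dim}A\in\{0,1,2,\dots,\infty\}$ be the supremum of all $n\ge0$ such that the first $n$ terms $I_1,\dots,I_n$ of a minimal injective resolution $0\to A\to I_1\to I_2\to\cdots$ of the left regular module ${}_AA$ are projective. Then: (a) If $R=R'$, then $\operatorname{dom.dim}B=\operatorname{dom.dim}B'$. (b) If $R'\subsetneq R$ and $R\cap S'=R'$, then $\operatorname{dom.dim}B'=0$ implies $\operatorname{dom.dim}B=0$. -/

import Mathlib

universe w v u

namespace TreeAlgebra

section Quivers

variable (V : Type u) [Quiver.{v} V]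

/-- The (oriented) paths of a quiver, including the trivial ones, with their source (first
component) and target (second component). -/
abbrev QPath : Type (max u v) := Σ a b : V, Quiver.Path a b

/-- A quiver is a tree if its underlying undirected (multi)graph is a tree: no loops, no multiple
edges, and the underlying simple graph is connected and acyclic. -/
structure IsTree : Prop where
  subsingleton_hom : ∀ a b : V, Subsingleton (a ⟶ b)
  asymm : ∀ a b : V, Nonempty (a ⟶ b) → IsEmpty (b ⟶ a)
  graph_isTree : (SimpleGraph.fromRel fun a b : V => Nonempty (a ⟶ b)).IsTree

variable {V}

/-- A source: no arrow ends in `a`. -/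
def IsSource (a : V) : Prop := ∀ b : V, IsEmpty (b ⟶ a)

/-- A sink: no arrow starts in `a`. -/
def IsSink (a : V) : Prop := ∀ b : V, IsEmpty (a ⟶ b)

/-- A branching vertex: two distinct arrows start in `a`, or two distinct arrows end in `a`. -/
def IsBranching (a : V) : Prop := Nontrivial (Quiver.Star a) ∨ Nontrivial (Quiver.Costar a)

/-- The path `p` from `a` to `b` is a left arm: it runs from a source to an immediate predecessor
of a branching vertex, through vertices that are not branching. The arm is the linearly oriented
quiver formed by the vertices and arrows of `p`; it is non-trivial iff `p` has positive length. -/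
def IsLeftArm {a b : V} (p : Quiver.Path a b) : Prop :=
  IsSource a ∧ (∃ c : V, Nonempty (b ⟶ c) ∧ IsBranching c) ∧ ∀ x ∈ p.vertices, ¬ IsBranching x

/-- The path `p` from `a` to `b` is a right arm: it runs from an immediate successor of a branching
vertex to a sink, through vertices that are not branching. -/
def IsRightArm {a b : V} (p : Quiver.Path a b) : Prop :=
  IsSink b ∧ (∃ c : V, Nonempty (c ⟶ a) ∧ IsBranching c) ∧ ∀ x ∈ p.vertices, ¬ IsBranching x

variable (V) in
/-- The quiver has a non-trivial arm. -/
def HasArms : Prop :=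
  ∃ (a b : V) (p : Quiver.Path a b), 0 < p.length ∧ (IsLeftArm p ∨ IsRightArm p)

/-- The vertices that are dropped when every arm is shortened to a trivial arm: the vertices of a
left arm other than its last one (the neighbour of the branching vertex), and the vertices of a
right arm other than its first one (the neighbour of the branching vertex). -/
def IsDropped (x : V) : Prop :=
  (∃ (a b : V) (p : Quiver.Path a b), IsLeftArm p ∧ x ∈ p.vertices ∧ x ≠ b) ∨
  (∃ (a b : V) (p : Quiver.Path a b), IsRightArm p ∧ x ∈ p.vertices ∧ x ≠ a)

variable (V) in
/-- The vertices of the armless subtree `Q'`. -/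
def Armless : Type u := {x : V // ¬ IsDropped x}

/-- `Q'` is a full subquiver. -/
instance : Quiver.{v} (Armless V) := ⟨fun a b => a.1 ⟶ b.1⟩

open Classical in
noncomputable instance [Fintype V] : Fintype (Armless V) :=
  inferInstanceAs (Fintype {x : V // ¬ IsDropped x})

variable (V) in
/-- The inclusion of the armless subtree. -/
def Armless.incl : Armless V ⥤q V where
  obj x := x.1
  map f := f

/-- A path of the armless subtree, viewed as a path of the tree. -/
def Armless.path (p : QPath (Armless V)) : QPath V :=
  ⟨p.1.1, p.2.1.1, (Armless.incl V).mapPath p.2.2⟩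

variable (V) in
/-- The set of all possible zero relations, that is, of all paths of length at least two. -/
def zeroRelations : Set (QPath V) := {p | 2 ≤ p.2.2.length}

end Quivers

section PathAlgebra

variable (K : Type w) [Field K] (V : Type u) [Quiver.{v} V]

/-- The path algebra `KQ`: the vector space with basis the paths of the quiver. -/
def PathAlgebra : Type (max u v w) := QPath V →₀ K

noncomputable instance : AddCommGroup (PathAlgebra K V) := inferInstanceAs (AddCommGroup (_ →₀ K))

noncomputable instance : Module K (PathAlgebra K V) := inferInstanceAs (Module K (_ →₀ K))

/-- The basis of the path algebra consisting of the paths. -/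
noncomputable def PathAlgebra.basis : Module.Basis (QPath V) K (PathAlgebra K V) :=
  Module.Basis.ofRepr (LinearEquiv.refl K (QPath V →₀ K))

variable {V}

/-- The basis element of the path algebra given by a path. -/
noncomputable def PathAlgebra.of (p : QPath V) : PathAlgebra K V := PathAlgebra.basis K V p

open Classical in
/-- The product `p * q` of two paths is the path "first `q`, then `p`" if `q` ends where `p`
starts, and `0` otherwise. -/
noncomputable def PathAlgebra.pathMul (p q : QPath V) : PathAlgebra K V :=
  if h : p.1 = q.2.1 then PathAlgebra.of K ⟨q.1, p.2.1, q.2.2.comp (p.2.2.cast h rfl)⟩ else 0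

variable (V) in
/-- The bilinear extension of the product of paths. -/
noncomputable def PathAlgebra.mulHom :
    PathAlgebra K V →ₗ[K] PathAlgebra K V →ₗ[K] PathAlgebra K V :=
  (PathAlgebra.basis K V).constr K fun p =>
    (PathAlgebra.basis K V).constr K fun q => PathAlgebra.pathMul K p q

noncomputable instance : Mul (PathAlgebra K V) := ⟨fun x y => PathAlgebra.mulHom K V x y⟩

/-- The unit is the sum of the trivial paths. -/
noncomputable instance [Fintype V] : One (PathAlgebra K V) :=
  ⟨∑ a : V, PathAlgebra.of K ⟨a, a, Quiver.Path.nil⟩⟩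

namespace PathAlgebra

variable {K}

theorem mul_def (x y : PathAlgebra K V) : x * y = mulHom K V x y := rfl

theorem of_mul_of (p q : QPath V) : of K p * of K q = pathMul K p q := by
  rw [mul_def, mulHom, of, of, Module.Basis.constr_basis, Module.Basis.constr_basis]

theorem induction_on {P : PathAlgebra K V → Prop} (x : PathAlgebra K V) (h0 : P 0)
    (hadd : ∀ x y, P x → P y → P (x + y)) (hof : ∀ (r : K) p, P (r • of K p)) : P x := by
  have key : ∀ f : QPath V →₀ K, P ((basis K V).repr.symm f) := fun f => by
    refine Finsupp.induction_linear f (by simpa using h0) (fun f g hf hg => ?_) fun p r => ?_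
    · rw [map_add]
      exact hadd _ _ hf hg
    · rw [Module.Basis.repr_symm_single]
      exact hof r p
  simpa using key ((basis K V).repr x)

theorem of_mul_of_mul_of (p q r : QPath V) :
    of K p * of K q * of K r = of K p * (of K q * of K r) := by
  obtain ⟨a, b, p⟩ := p
  obtain ⟨c, d, q⟩ := q
  obtain ⟨e, f, r⟩ := r
  have zm : ∀ x : PathAlgebra K V, 0 * x = 0 := fun x => by simp [mul_def]
  have mz : ∀ x : PathAlgebra K V, x * 0 = 0 := fun x => by simp [mul_def]
  rw [of_mul_of, of_mul_of]
  by_cases h1 : a = d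
  · subst h1
    by_cases h2 : c = f
    · subst h2
      simp [pathMul, of_mul_of]
    · simp [pathMul, h2, of_mul_of, mz]
  · by_cases h2 : c = f
    · subst h2
      simp [pathMul, h1, of_mul_of, zm]
    · simp [pathMul, h1, h2, zm, mz]

end PathAlgebra

/-- The path algebra is a ring. -/
noncomputable instance [Fintype V] : Ring (PathAlgebra K V) where
  __ := (inferInstance : AddCommGroup (PathAlgebra K V))
  __ := (inferInstance : Mul (PathAlgebra K V))
  __ := (inferInstance : One (PathAlgebra K V))
  left_distrib x y z := by simp [PathAlgebra.mul_def]
  right_distrib x y z := by simp [PathAlgebra.mul_def]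
  zero_mul x := by simp [PathAlgebra.mul_def]
  mul_zero x := by simp [PathAlgebra.mul_def]
  mul_assoc x y z := by
    induction x using PathAlgebra.induction_on with
    | h0 => simp [PathAlgebra.mul_def]
    | hadd x x' hx hx' => simp only [PathAlgebra.mul_def, map_add, LinearMap.add_apply] at *
                          rw [hx, hx']
    | hof r p =>
    induction y using PathAlgebra.induction_on with
    | h0 => simp [PathAlgebra.mul_def]
    | hadd y y' hy hy' => simp only [PathAlgebra.mul_def, map_add, LinearMap.add_apply] at *
                          rw [hy, hy']
    | hof s q =>
    induction z using PathAlgebra.induction_on with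
    | h0 => simp [PathAlgebra.mul_def]
    | hadd z z' hz hz' => simp only [PathAlgebra.mul_def, map_add] at *
                          rw [hz, hz']
    | hof t o =>
    have := PathAlgebra.of_mul_of_mul_of (K := K) p q o
    simp only [PathAlgebra.mul_def, map_smul, LinearMap.smul_apply] at *
    rw [this]
  one_mul x := by
    induction x using PathAlgebra.induction_on with
    | h0 => simp [PathAlgebra.mul_def]
    | hadd x y hx hy =>
      rw [PathAlgebra.mul_def] at *
      rw [map_add, hx, hy]
    | hof r p =>
      obtain ⟨a, b, p⟩ := p
      have h : (∑ c : V, PathAlgebra.of K ⟨c, c, Quiver.Path.nil⟩) *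
          PathAlgebra.of K ⟨a, b, p⟩ = PathAlgebra.of K ⟨a, b, p⟩ := by
        rw [PathAlgebra.mul_def, map_sum, LinearMap.sum_apply]
        simp only [← PathAlgebra.mul_def, PathAlgebra.of_mul_of]
        rw [Finset.sum_eq_single b]
        · simp [PathAlgebra.pathMul]
        · intro c _ hc
          simp [PathAlgebra.pathMul, hc]
        · simp
      rw [PathAlgebra.mul_def] at *
      rw [map_smul]
      exact congrArg (r • ·) h
  mul_one x := by
    induction x using PathAlgebra.induction_on with
    | h0 => simp [PathAlgebra.mul_def]
    | hadd x y hx hy =>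
      rw [PathAlgebra.mul_def] at *
      rw [map_add, LinearMap.add_apply, hx, hy]
    | hof r p =>
      obtain ⟨a, b, p⟩ := p
      have h : PathAlgebra.of K ⟨a, b, p⟩ *
          (∑ c : V, PathAlgebra.of K ⟨c, c, Quiver.Path.nil⟩) = PathAlgebra.of K ⟨a, b, p⟩ := by
        rw [PathAlgebra.mul_def, map_sum]
        simp only [← PathAlgebra.mul_def, PathAlgebra.of_mul_of]
        rw [Finset.sum_eq_single a]
        · simp [PathAlgebra.pathMul]
        · intro c _ hc
          simp [PathAlgebra.pathMul, hc.symm]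
        · simp
      rw [PathAlgebra.mul_def] at *
      rw [map_smul, LinearMap.smul_apply]
      exact congrArg (r • ·) h

/-- The path algebra is a `K`-algebra. -/
noncomputable instance [Fintype V] : Algebra K (PathAlgebra K V) :=
  Algebra.ofModule (fun r x y => by simp [PathAlgebra.mul_def])
    (fun r x y => by simp [PathAlgebra.mul_def])

variable [Fintype V]

/-- The ideal of the path algebra generated by a set of paths. -/
noncomputable def relationIdeal (R : Set (QPath V)) : TwoSidedIdeal (PathAlgebra K V) :=
  TwoSidedIdeal.span (PathAlgebra.of K '' R)

/-- The bound quiver algebra `KQ/I`, where `I` is the ideal generated by `R`. -/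
abbrev BoundQuiverAlgebra (R : Set (QPath V)) : Type (max u v w) :=
  (relationIdeal K R).ringCon.Quotient

end PathAlgebra

section DominantDimension

variable (A : Type u) [Ring A] (M : Type u) [AddCommGroup M] [Module A M]

/-- A minimal injective resolution `0 → M → I 0 → I 1 → ⋯` of the left `A`-module `M`: an exact
sequence with injective terms `I n`, in which each `I n` is an injective envelope of the kernel of
`I n → I (n + 1)`, i.e. this kernel is an essential submodule of `I n`. -/
structure MinimalInjectiveResolution where
  I : ℕ → Type u
  [addCommGroup : ∀ n, AddCommGroup (I n)]
  [module : ∀ n, Module A (I n)]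
  injective : ∀ n, Module.Injective A (I n)
  ι : M →ₗ[A] I 0
  d : ∀ n, I n →ₗ[A] I (n + 1)
  ι_injective : Function.Injective ι
  exact_zero : LinearMap.range ι = LinearMap.ker (d 0)
  exact_succ : ∀ n, LinearMap.range (d n) = LinearMap.ker (d (n + 1))
  essential : ∀ n, ∀ N : Submodule A (I n), N ⊓ LinearMap.ker (d n) = ⊥ → N = ⊥

attribute [instance] MinimalInjectiveResolution.addCommGroup MinimalInjectiveResolution.module

/-- The dominant dimension of `M` is at least `n`: in some minimal injective resolution of `M`,
the first `n` (injective) terms are projective. -/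
def DomDimAtLeast (n : ℕ) : Prop :=
  ∃ E : MinimalInjectiveResolution A M, ∀ j < n, Module.Projective A (E.I j)

/-- The dominant dimension of a module, possibly infinite: the supremum of all `n` such that it is
at least `n`. -/
noncomputable def moduleDomDim : ℕ∞ := ⨆ (n : ℕ) (_ : DomDimAtLeast A M n), (n : ℕ∞)

/-- The dominant dimension of an algebra is that of its left regular module. -/
noncomputable def domDim : ℕ∞ := moduleDomDim A A

end DominantDimension

end TreeAlgebra

namespace TreeAlgebra

/-! ### Injective envelopes and minimal injective resolutions -/

section InjectiveHulls

variable {A : Type u} [Ring A]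

/-! A tree has at most one path between two vertices. So its vertices form a poset whose intervals
are chains, and the bound quiver algebra has a basis `E a b` indexed by the pairs `a ≤ b` whose
interval contains no relation (`boundPairBasis`). These pairs form a relation `N` closed under
subintervals, and the dominant dimensions are read off from it.

The left projective at `u` has the basis `E u y`, and the injective at `w` is dual to the span of
the `E x w`. A perfect pair `(u, w)` makes the projective at `u` injective (`baer_proj`);
conversely, socle elements of projective-injective modules sit at right ends of perfect pairs
(`exists_isPerfect_of_socle`). Hence the dominant dimension is at least one iff every pair of `N`
lies inside a perfect pair (`IsCovered`).

A branching vertex bounds the dominant dimension by one. If two arrows leave `v`, some element of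
the injective envelope acts like the trivial path on one branch and like zero on the others, so the
simple at `v` occurs in the first cosyzygy. A projective second term would make `v` the right end of
a perfect pair, which a covered relation forbids (`IsCovered.not_isPerfect`). If two arrows enter a
vertex, a covered relation has two arrows leaving some other vertex (`IsCovered.exists_covBy`). So
both dominant dimensions are one or zero, according to whether the relation is covered.

It remains to compare coverings. Coveredness passes from the tree to the armless subtree
(`IsCovered.restrict`), which gives (b) and half of (a). If all relations live on the subtree,
contracting the arms preserves and reflects `N`, and perfect pairs are stretched back along the arms
(`IsCovered.extend`). -/

theorem exists_maximal_disjoint {J : Type*} [AddCommGroup J] [Module A J] (E : Submodule A J) :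
    ∃ C : Submodule A J, Maximal (fun C => C ⊓ E = ⊥) C := by
  obtain ⟨C, -, hC⟩ := zorn_le_nonempty₀ {C : Submodule A J | C ⊓ E = ⊥} (fun c hc hch C hCc => by
    refine ⟨sSup c, ?_, fun D hD => le_sSup hD⟩
    change sSup c ⊓ E = ⊥
    rw [eq_bot_iff]
    rintro x ⟨hx, hxE⟩
    obtain ⟨D, hD, hxD⟩ := (Submodule.mem_sSup_of_directed ⟨C, hCc⟩ hch.directedOn).1 hx
    have := hc hD
    rw [← this]
    exact ⟨hxD, hxE⟩) ⊥ (by simp)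
  exact ⟨C, hC⟩

/-- In an injective module, every submodule is essential in some direct summand. -/
theorem exists_essential_summand {J : Type u} [AddCommGroup J] [Module A J]
    [Module.Injective A J] (M : Submodule A J) :
    ∃ E : Submodule A J, M ≤ E ∧ (∀ N ≤ E, N ⊓ M = ⊥ → N = ⊥) ∧
      ∃ p : J →ₗ[A] E, ∀ x : E, p x = x := by
  obtain ⟨E, -, hE⟩ := zorn_le_nonempty₀
    {E : Submodule A J | M ≤ E ∧ ∀ N ≤ E, N ⊓ M = ⊥ → N = ⊥} (fun c hc hch E hEc => by
      refine ⟨sSup c, ⟨(hc hEc).1.trans (le_sSup hEc), fun N hN hNM => ?_⟩, fun D hD => le_sSup hD⟩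
      rw [eq_bot_iff]
      intro x hx
      obtain ⟨D, hD, hxD⟩ :=
        (Submodule.mem_sSup_of_directed ⟨E, hEc⟩ hch.directedOn).1 (hN hx)
      have h := (hc hD).2 (A ∙ x) (by simpa using hxD) (by
        rw [eq_bot_iff, ← hNM]
        exact inf_le_inf_right _ (by simpa using hx))
      rw [← h]
      exact Submodule.mem_span_singleton_self x) M
    ⟨le_rfl, fun N hN h => by rwa [inf_eq_left.2 hN] at h⟩
  obtain ⟨⟨hME, hess⟩, hmax⟩ := hE
  -- As `C` misses `E`, the module `E` embeds into `J ⧸ C`. Extending the inclusion of `E` along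
  -- this embedding yields an endomorphism `k` of `J` that fixes `E` and kills `C`.
  obtain ⟨C, hCE, hCmax⟩ := exists_maximal_disjoint E
  obtain ⟨h, hh⟩ := Module.Injective.out (R := A) (Q := J) (C.mkQ ∘ₗ E.subtype) (by
    rw [← LinearMap.ker_eq_bot, eq_bot_iff]
    intro x hx
    have hxC : (x : J) ∈ C := by simpa using hx
    have : (x : J) ∈ C ⊓ E := ⟨hxC, x.2⟩
    rw [hCE] at this
    simpa using this) E.subtype
  set k : J →ₗ[A] J := h ∘ₗ C.mkQ with hk
  have hkE : ∀ x ∈ E, k x = x := fun x hx => hh ⟨x, hx⟩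
  have hkC : ∀ x ∈ C, k x = 0 := fun x hx => by
    rw [hk, LinearMap.comp_apply, Submodule.mkQ_apply, (Submodule.Quotient.mk_eq_zero C).2 hx,
      map_zero]
  have hER : E ≤ LinearMap.range k := fun x hx => ⟨x, hkE x hx⟩
  -- The range of `k` is again an essential extension of `M`: if a submodule of it misses `E`, so
  -- does its preimage, which then lies in `C` and is killed. Maximality of `E` makes `k` a
  -- projection onto `E`.
  have hR : LinearMap.range k ≤ E := by
    refine hmax ⟨hME.trans hER, fun N hN hNM => ?_⟩ hER
    have hNE : N ⊓ E = ⊥ := hess _ inf_le_right (by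
      rw [eq_bot_iff, ← hNM]
      exact inf_le_inf_right _ inf_le_left)
    have hCP : N.comap k ≤ C := by
      refine hCmax ?_ fun x hx => ?_
      · change N.comap k ⊓ E = ⊥
        rw [eq_bot_iff, ← hNE]
        rintro x ⟨hx, hxE⟩
        exact ⟨by simpa [hkE x hxE] using hx, hxE⟩
      · simp [hkC x hx]
    rw [eq_bot_iff]
    intro n hn
    obtain ⟨j, rfl⟩ := hN hn
    simp [hkC j (hCP hn)]
  exact ⟨E, hME, hess, k.codRestrict E fun x => hR ⟨x, rfl⟩, fun x => Subtype.ext (hkE x x.2)⟩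

/-- An injective envelope of a module. -/
structure InjectiveHull (M : ModuleCat.{u} A) where
  I : ModuleCat.{u} A
  ι : M →ₗ[A] I
  injective : Module.Injective A I
  ι_injective : Function.Injective ι
  essential : ∀ N : Submodule A I, N ⊓ LinearMap.range ι = ⊥ → N = ⊥

/-- The retraction is kept in the conclusion so that projectivity of `J` passes to the hull. -/
theorem exists_injectiveHull_retract {M J : ModuleCat.{u} A} (hJ : Module.Injective A J)
    (f : M →ₗ[A] J) (hf : Function.Injective f) :
    ∃ (H : InjectiveHull M) (s : H.I →ₗ[A] J) (r : J →ₗ[A] H.I), r ∘ₗ s = LinearMap.id := by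
  obtain ⟨E, hfE, hess, p, hp⟩ := exists_essential_summand (LinearMap.range f)
  have hpE : p ∘ₗ E.subtype = LinearMap.id := LinearMap.ext hp
  refine ⟨⟨ModuleCat.of A E, f.codRestrict E fun x => hfE ⟨x, rfl⟩, ⟨?_⟩, ?_, ?_⟩, E.subtype, p, hpE⟩
  · intro X Y _ _ _ _ i hi g
    obtain ⟨h, hh⟩ := hJ.out i hi (E.subtype ∘ₗ g)
    exact ⟨p ∘ₗ h, fun x => by
      rw [LinearMap.comp_apply, hh]
      exact hp (g x)⟩
  · intro x y hxy
    exact hf (congrArg Subtype.val hxy)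
  · intro N hN
    have h := hess (N.map E.subtype) (Submodule.map_subtype_le E N) (by
      rw [eq_bot_iff]
      rintro _ ⟨⟨x, hx, rfl⟩, ⟨m, hm⟩⟩
      have : x ∈ N ⊓ LinearMap.range (f.codRestrict E fun x => hfE ⟨x, rfl⟩) :=
        ⟨hx, m, Subtype.ext hm⟩
      have h0 : x = 0 := by simpa [hN] using this
      simp [h0])
    exact Submodule.map_injective_of_injective E.injective_subtype (by rw [h, Submodule.map_bot])

theorem nonempty_injectiveHull (M : ModuleCat.{u} A) : Nonempty (InjectiveHull M) := by
  obtain ⟨P⟩ := CategoryTheory.EnoughInjectives.presentation M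
  obtain ⟨H, -⟩ := exists_injectiveHull_retract
    ((Module.injective_iff_injective_object A P.J).2 P.injective) P.f.hom
    ((ModuleCat.mono_iff_injective _).1 P.mono)
  exact ⟨H⟩

/-- The modules of which the terms of the minimal injective resolution of `M` built from the
hulls `h` are the injective envelopes. -/
def cosyzygy (h : ∀ M : ModuleCat.{u} A, InjectiveHull M) (M : ModuleCat.{u} A) :
    ℕ → ModuleCat.{u} A
  | 0 => M
  | n + 1 => ModuleCat.of A ((h (cosyzygy h M n)).I ⧸ LinearMap.range (h (cosyzygy h M n)).ι)

/-- The projection of the injective envelope of a cosyzygy to the next cosyzygy. -/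
def cosyzygyProj (h : ∀ M : ModuleCat.{u} A, InjectiveHull M) (M : ModuleCat.{u} A) (n : ℕ) :
    (h (cosyzygy h M n)).I →ₗ[A] cosyzygy h M (n + 1) :=
  (LinearMap.range (h (cosyzygy h M n)).ι).mkQ

theorem ker_cosyzygyProj (h : ∀ M : ModuleCat.{u} A, InjectiveHull M) (M : ModuleCat.{u} A)
    (n : ℕ) : LinearMap.ker (cosyzygyProj h M n) = LinearMap.range (h (cosyzygy h M n)).ι :=
  Submodule.ker_mkQ _

theorem range_cosyzygyProj (h : ∀ M : ModuleCat.{u} A, InjectiveHull M) (M : ModuleCat.{u} A)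
    (n : ℕ) : LinearMap.range (cosyzygyProj h M n) = ⊤ :=
  Submodule.range_mkQ _

/-- The minimal injective resolution built from a choice of injective envelopes. -/
noncomputable def resolutionOfHulls (h : ∀ M : ModuleCat.{u} A, InjectiveHull M)
    (M : ModuleCat.{u} A) : MinimalInjectiveResolution A M :=
  have hker : ∀ n, LinearMap.range (h (cosyzygy h M n)).ι =
      LinearMap.ker ((h (cosyzygy h M (n + 1))).ι ∘ₗ cosyzygyProj h M n) := fun n => by
    rw [LinearMap.ker_comp, LinearMap.ker_eq_bot.2 (h (cosyzygy h M (n + 1))).ι_injective,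
      Submodule.comap_bot, ker_cosyzygyProj]
  { I n := (h (cosyzygy h M n)).I
    injective n := (h (cosyzygy h M n)).injective
    ι := (h M).ι
    d n := (h (cosyzygy h M (n + 1))).ι ∘ₗ cosyzygyProj h M n
    ι_injective := (h M).ι_injective
    exact_zero := hker 0
    exact_succ n := by
      rw [← hker (n + 1)]
      exact LinearMap.range_comp_of_range_eq_top _ (range_cosyzygyProj h M n)
    essential n N hN := (h (cosyzygy h M n)).essential N (by rwa [hker n]) }

/-- A module that embeds into a projective-injective module has dominant dimension at least one. -/
theorem domDimAtLeast_one {M : Type u} [AddCommGroup M] [Module A M] {J : Type u}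
    [AddCommGroup J] [Module A J] (hJ : Module.Injective A J) (hP : Module.Projective A J)
    (f : M →ₗ[A] J) (hf : Function.Injective f) : DomDimAtLeast A M 1 := by
  classical
  obtain ⟨H, s, r, hrs⟩ := exists_injectiveHull_retract (M := ModuleCat.of A M)
    (J := ModuleCat.of A J) hJ f hf
  have hH : Module.Projective A H.I := Module.Projective.of_split s r hrs
  -- Choosing a projective hull wherever one exists makes the term in degree zero projective.
  let h : ∀ M : ModuleCat.{u} A, InjectiveHull M := fun M =>
    if h : ∃ H : InjectiveHull M, Module.Projective A H.I then h.choose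
    else (nonempty_injectiveHull M).some
  refine ⟨resolutionOfHulls h (ModuleCat.of A M), fun j hj => ?_⟩
  obtain rfl : j = 0 := by omega
  have hex : ∃ H : InjectiveHull (ModuleCat.of A M), Module.Projective A H.I := ⟨H, hH⟩
  change Module.Projective A (h (ModuleCat.of A M)).I
  rw [show h (ModuleCat.of A M) = hex.choose from dif_pos hex]
  exact hex.choose_spec

end InjectiveHulls

theorem DomDimAtLeast.mono {A : Type u} [Ring A] {M : Type u} [AddCommGroup M] [Module A M]
    {m n : ℕ} (hmn : m ≤ n) (h : DomDimAtLeast A M n) : DomDimAtLeast A M m :=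
  h.imp fun _ hE j hj => hE j (hj.trans_le hmn)

theorem domDim_eq_zero_iff (A : Type u) [Ring A] : domDim A = 0 ↔ ¬ DomDimAtLeast A A 1 := by
  rw [domDim, moduleDomDim, ← nonpos_iff_eq_zero, iSup₂_le_iff]
  refine ⟨fun h h1 => by simpa using h 1 h1, fun h n hn => ?_⟩
  obtain rfl : n = 0 := by
    by_contra hn0
    exact h (hn.mono (by omega))
  simp

theorem domDim_eq_one {A : Type u} [Ring A] (h1 : DomDimAtLeast A A 1)
    (h2 : ¬ DomDimAtLeast A A 2) : domDim A = 1 := by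
  refine le_antisymm (iSup₂_le fun n hn => ?_) (le_iSup₂_of_le 1 h1 (by simp))
  have : n ≤ 1 := by
    by_contra hn1
    exact h2 (hn.mono (by omega))
  exact_mod_cast this

/-! ### Perfect pairs and algebras with a path-like basis -/

section Perfect

variable {V : Type*} [PartialOrder V]

/-- A reflexive subrelation of the order that is closed under passing to subintervals. -/
structure IsConvexRel (N : V → V → Prop) : Prop where
  le : ∀ {a b}, N a b → a ≤ b
  refl : ∀ a, N a a
  mono : ∀ {a b c d}, a ≤ c → c ≤ d → d ≤ b → N a b → N c d

/-- The pair `(u, w)` encodes an indecomposable projective-injective module: the projective at `u`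
is the injective at `w`. -/
structure IsPerfect (N : V → V → Prop) (u w : V) : Prop where
  rel : N u w
  left : ∀ x, N x w → u ≤ x
  right : ∀ y, N u y → y ≤ w

/-- Every related pair lies in a perfect pair. -/
def IsCovered (N : V → V → Prop) : Prop :=
  ∀ a b, N a b → ∃ u w, IsPerfect N u w ∧ u ≤ a ∧ b ≤ w

variable (V) in
/-- All intervals are chains. -/
def HasChainIntervals : Prop :=
  ∀ a b x y : V, a ≤ x → x ≤ b → a ≤ y → y ≤ b → x ≤ y ∨ y ≤ x

end Perfect

/-- A basis of an algebra consisting of elements `E a b` for the related pairs `(a, b)`,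
multiplied like paths from `a` to `b`. -/
structure PairBasis (K : Type*) (A : Type*) {V : Type*} [Field K] [Ring A] [Algebra K A]
    [Fintype V] (N : V → V → Prop) where
  E : V → V → A
  coeff : V → V → A →ₗ[K] K
  E_eq_zero : ∀ {a b}, ¬ N a b → E a b = 0
  coeff_E_self : ∀ {a b}, N a b → coeff a b (E a b) = 1
  coeff_E_ne : ∀ {a b a' b'}, ¬ (a = a' ∧ b = b') → coeff a b (E a' b') = 0
  sum_coeff : ∀ x, ∑ a, ∑ b, coeff a b x • E a b = x
  mul_self : ∀ {a b c}, N a b → N b c → E b c * E a b = E a c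
  mul_ne : ∀ {a b c d}, b ≠ c → E c d * E a b = 0

namespace PairBasis

section Basic

open scoped Classical

variable {K A V : Type*} [Field K] [Ring A] [Algebra K A] [Fintype V] {N : V → V → Prop}
  (B : PairBasis K A N)

include B

theorem hom_ext {M : Type*} [AddCommGroup M] [Module K M] {f g : A →ₗ[K] M}
    (h : ∀ a b, N a b → f (B.E a b) = g (B.E a b)) : f = g := by
  ext x
  rw [← B.sum_coeff x]
  simp only [map_sum, map_smul]
  refine Finset.sum_congr rfl fun a _ => Finset.sum_congr rfl fun b _ => ?_
  by_cases hN : N a b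
  · rw [h a b hN]
  · rw [B.E_eq_zero hN, map_zero, map_zero]

theorem coeff_E {a b a' b' : V} :
    B.coeff a b (B.E a' b') = if a = a' ∧ b = b' ∧ N a b then 1 else 0 := by
  split_ifs with h
  · obtain ⟨rfl, rfl, h⟩ := h
    exact B.coeff_E_self h
  · by_cases h' : a = a' ∧ b = b'
    · obtain ⟨rfl, rfl⟩ := h'
      rw [B.E_eq_zero fun hN => h ⟨rfl, rfl, hN⟩, map_zero]
    · exact B.coeff_E_ne h'

theorem coeff_eq_zero {a b : V} (h : ¬ N a b) (x : A) : B.coeff a b x = 0 := by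
  have : B.coeff a b = 0 := B.hom_ext fun a' b' _ => by simp [B.coeff_E, h]
  rw [this, LinearMap.zero_apply]

theorem ext_coeff {x y : A} (h : ∀ a b, N a b → B.coeff a b x = B.coeff a b y) : x = y := by
  rw [← B.sum_coeff x, ← B.sum_coeff y]
  refine Finset.sum_congr rfl fun a _ => Finset.sum_congr rfl fun b _ => ?_
  by_cases hN : N a b
  · rw [h a b hN]
  · rw [B.E_eq_zero hN, smul_zero, smul_zero]

/-- Left multiplication by `E c d` moves targets from `c` to `d`, so coefficients at `(a, c)` become
coefficients at `(a, d)` as long as `(a, d)` is still related. -/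
theorem coeff_E_mul (a b c d : V) (x : A) :
    B.coeff a b (B.E c d * x) = if b = d ∧ N c d ∧ N a b then B.coeff a c x else 0 := by
  split_ifs with h
  · obtain ⟨rfl, hcd, had⟩ := h
    have : B.coeff a b ∘ₗ LinearMap.mulLeft K (B.E c b) = B.coeff a c :=
      B.hom_ext fun a' b' h' => by
        rw [LinearMap.comp_apply, LinearMap.mulLeft_apply]
        by_cases hb : b' = c
        · subst hb
          rw [B.mul_self h' hcd, B.coeff_E, B.coeff_E]
          by_cases haa : a = a'
          · subst haa
            simp [had, h']
          · simp [haa]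
        · rw [B.mul_ne hb, map_zero, B.coeff_E, if_neg fun h => hb h.2.1.symm]
    exact LinearMap.congr_fun this x
  · have : B.coeff a b ∘ₗ LinearMap.mulLeft K (B.E c d) = 0 :=
      B.hom_ext fun a' b' h' => by
        rw [LinearMap.comp_apply, LinearMap.mulLeft_apply, LinearMap.zero_apply]
        by_cases hcd : N c d
        · by_cases hb : b' = c
          · subst hb
            rw [B.mul_self h' hcd, B.coeff_E, if_neg]
            rintro ⟨rfl, rfl, hab⟩
            exact h ⟨rfl, hcd, hab⟩
          · rw [B.mul_ne hb, map_zero]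
        · rw [B.E_eq_zero hcd, zero_mul, map_zero]
    exact LinearMap.congr_fun this x

theorem coeff_mul_E (a b c d : V) (x : A) :
    B.coeff a b (x * B.E c d) = if a = c ∧ N c d ∧ N a b then B.coeff d b x else 0 := by
  split_ifs with h
  · obtain ⟨rfl, hcd, hab⟩ := h
    have : B.coeff a b ∘ₗ LinearMap.mulRight K (B.E a d) = B.coeff d b :=
      B.hom_ext fun a' b' h' => by
        rw [LinearMap.comp_apply, LinearMap.mulRight_apply]
        by_cases hb : d = a'
        · subst hb
          rw [B.mul_self hcd h', B.coeff_E, B.coeff_E]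
          by_cases hbb : b = b'
          · subst hbb
            simp [hab, h']
          · simp [hbb]
        · rw [B.mul_ne hb, map_zero, B.coeff_E, if_neg fun h => hb h.1]
    exact LinearMap.congr_fun this x
  · have : B.coeff a b ∘ₗ LinearMap.mulRight K (B.E c d) = 0 :=
      B.hom_ext fun a' b' h' => by
        rw [LinearMap.comp_apply, LinearMap.mulRight_apply, LinearMap.zero_apply]
        by_cases hcd : N c d
        · by_cases hb : d = a'
          · subst hb
            rw [B.mul_self hcd h', B.coeff_E, if_neg]
            rintro ⟨rfl, rfl, hab⟩
            exact h ⟨rfl, hcd, hab⟩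
          · rw [B.mul_ne hb, map_zero]
        · rw [B.E_eq_zero hcd, mul_zero, map_zero]
    exact LinearMap.congr_fun this x

/-- Baer's criterion: an injective module contains elements on which the basis elements `E a b`
with `(a, b)` in a set of pairs closed under left multiplication act in a prescribed way. -/
theorem exists_smul_eq {J : Type*} [AddCommGroup J] [Module A J] (hJ : Module.Baer A J)
    (T : V → V → Prop) (hT : ∀ a b c, T a b → N b c → T a c) (m : V → V → J)
    (hm : ∀ a b c d, T a b → N a b → N c d →
      B.E c d • m a b = if c = b ∧ N a d then m a d else 0) :
    ∃ j : J, ∀ a b, T a b → N a b → B.E a b • j = m a b := by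
  let _ : Module K J := Module.compHom J (algebraMap K A)
  have : IsScalarTower K A J := ⟨fun k a j => by
    rw [Algebra.smul_def, mul_smul]
    rfl⟩
  have : SMulCommClass A K J := ⟨fun a k j => by
    change a • algebraMap K A k • j = algebraMap K A k • a • j
    rw [← mul_smul, ← mul_smul, Algebra.commutes]⟩
  let g : A →ₗ[K] J := ∑ a, ∑ b, (B.coeff a b).smulRight (if T a b then m a b else 0)
  have hg : ∀ y, g y = ∑ a, ∑ b, B.coeff a b y • (if T a b then m a b else 0) := fun y => by
    simp [g]
  -- The span of the `E a b` with `T a b`, a left ideal because `T` survives prolonging at the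
  -- target. There `g` sends `E a b` to `m a b` and is `A`-linear by `hm`; its extension to `A`,
  -- evaluated at `1`, is the required element.
  let I : Ideal A :=
    { carrier := {y | ∀ a b, ¬ T a b → B.coeff a b y = 0}
      add_mem' := fun {x y} hx hy a b h => by rw [map_add, hx a b h, hy a b h, add_zero]
      zero_mem' := fun a b _ => map_zero _
      smul_mem' := fun x y hy a b h => by
        have : B.coeff a b ∘ₗ LinearMap.mulRight K y = 0 := B.hom_ext fun c d hcd => by
          rw [LinearMap.comp_apply, LinearMap.mulRight_apply, LinearMap.zero_apply, B.coeff_E_mul]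
          split_ifs with h'
          · obtain ⟨rfl, -, -⟩ := h'
            exact hy a c fun hac => h (hT a c b hac hcd)
          · rfl
        exact LinearMap.congr_fun this x }
  have hlin : ∀ x, ∀ y ∈ I, g (x * y) = x • g y := fun x y hy => by
    have : g ∘ₗ LinearMap.mulRight K y = (LinearMap.toSpanSingleton A J (g y)).restrictScalars K :=
      B.hom_ext fun c d hcd => by
        rw [LinearMap.comp_apply, LinearMap.mulRight_apply, LinearMap.restrictScalars_apply,
          LinearMap.toSpanSingleton_apply, hg, hg, Finset.smul_sum]
        refine Finset.sum_congr rfl fun a _ => ?_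
        rw [Finset.smul_sum, Finset.sum_eq_single d, Finset.sum_eq_single c]
        · rw [B.coeff_E_mul, smul_comm]
          by_cases hac : T a c
          · by_cases hNac : N a c
            · rw [if_pos hac, if_pos (hT _ _ _ hac hcd), hm a c c d hac hNac hcd]
              by_cases had : N a d <;> simp [had, hcd]
            · rw [B.coeff_eq_zero hNac]
              simp
          · rw [hy a c hac]
            simp
        · intro b _ hb
          rw [smul_comm]
          by_cases hab : T a b
          · by_cases hNab : N a b
            · rw [if_pos hab, hm a b c d hab hNab hcd, if_neg fun h => hb h.1.symm, smul_zero]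
            · rw [B.coeff_eq_zero hNab, zero_smul]
          · rw [if_neg hab, smul_zero, smul_zero]
        · simp
        · intro b _ hb
          rw [B.coeff_E_mul, if_neg fun h => hb h.1, zero_smul]
        · simp
    exact LinearMap.congr_fun this x
  obtain ⟨g', hg'⟩ := hJ I
    { toFun := fun y => g y
      map_add' := fun x y => by simp
      map_smul' := fun x y => hlin x y y.2 }
  refine ⟨g' 1, fun a b hab hN => ?_⟩
  have hmem : B.E a b ∈ I := fun a' b' h => by
    rw [B.coeff_E, if_neg]
    rintro ⟨rfl, rfl, -⟩
    exact h hab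
  rw [← map_smul, smul_eq_mul, mul_one, hg' _ hmem]
  change g (B.E a b) = _
  rw [hg, Finset.sum_eq_single a, Finset.sum_eq_single b]
  · rw [B.coeff_E_self hN, one_smul, if_pos hab]
  · intro b' _ hb
    rw [B.coeff_E, if_neg fun h => hb h.2.1, zero_smul]
  · simp
  · intro a' _ ha
    refine Finset.sum_eq_zero fun b' _ => ?_
    rw [B.coeff_E, if_neg fun h => ha h.1, zero_smul]
  · simp

end Basic

end PairBasis

/-! ### Covered relations at branching vertices -/

section Perfect

variable {V : Type*} [PartialOrder V] {N : V → V → Prop}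

/-- If two arrows end in the same vertex, then a covered relation forces two arrows to start in
some vertex. -/
theorem IsCovered.exists_covBy [Fintype V] (hV : HasChainIntervals V) (hN : IsConvexRel N)
    (hC : IsCovered N) {x₁ x₂ z : V} (hx : x₁ ≠ x₂) (h₁ : x₁ ⋖ z) (h₂ : x₂ ⋖ z)
    (hN₁ : N x₁ z) (hN₂ : N x₂ z) :
    ∃ v n₁ n₂ : V, n₁ ≠ n₂ ∧ v ⋖ n₁ ∧ v ⋖ n₂ ∧ N v n₁ ∧ N v n₂ := by
  classical
  -- If `w₁ ≤ w₂`, perfectness puts `u₁` below `x₂`, so both lower neighbours of `z` lie in the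
  -- chain from `u₁` to `z`.
  have key : ∀ {x₁ x₂ u₁ w₁ w₂ : V}, x₁ ≠ x₂ → x₁ ⋖ z → x₂ ⋖ z → IsPerfect N u₁ w₁ →
      u₁ ≤ x₁ → z ≤ w₁ → w₁ ≤ w₂ → N x₂ w₂ → False := by
    intro x₁ x₂ u₁ w₁ w₂ hx h₁ h₂ hP hu hw hww hN2
    have hux : u₁ ≤ x₂ := hP.left x₂ (hN.mono le_rfl (h₂.le.trans hw) hww hN2)
    rcases hV u₁ z x₁ x₂ hu h₁.le hux h₂.le with h | h
    · exact h₁.2 (lt_of_le_of_ne h hx) h₂.lt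
    · exact h₂.2 (lt_of_le_of_ne h hx.symm) h₁.lt
  obtain ⟨u₁, w₁, hP₁, hu₁, hw₁⟩ := hC _ _ hN₁
  obtain ⟨u₂, w₂, hP₂, hu₂, hw₂⟩ := hC _ _ hN₂
  have hNx₁ : N x₁ w₁ := hN.mono hu₁ (h₁.le.trans hw₁) le_rfl hP₁.rel
  have hNx₂ : N x₂ w₂ := hN.mono hu₂ (h₂.le.trans hw₂) le_rfl hP₂.rel
  -- At `v` the paths from `z` to `w₁` and to `w₂` part; by `key` it is neither of these ends.
  obtain ⟨v, hzv, hv⟩ := Finite.exists_le_maximal (p := fun v => v ≤ w₁ ∧ v ≤ w₂) ⟨hw₁, hw₂⟩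
  have hv₁ : v < w₁ := lt_of_le_of_ne hv.prop.1 fun h => by
    subst h
    exact key hx h₁ h₂ hP₁ hu₁ hw₁ hv.prop.2 hNx₂
  have hv₂ : v < w₂ := lt_of_le_of_ne hv.prop.2 fun h => by
    subst h
    exact key hx.symm h₂ h₁ hP₂ hu₂ hw₂ hv.prop.1 hNx₁
  have hfin := @Fintype.toLocallyFiniteOrder V _ _ (Classical.decRel _) (Classical.decRel _)
  obtain ⟨n₁, hn₁, hnw₁⟩ := exists_covBy_le_of_lt hv₁
  obtain ⟨n₂, hn₂, hnw₂⟩ := exists_covBy_le_of_lt hv₂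
  refine ⟨v, n₁, n₂, ?_, hn₁, hn₂, hN.mono (h₁.le.trans hzv) hn₁.le hnw₁ hNx₁,
    hN.mono (h₂.le.trans hzv) hn₂.le hnw₂ hNx₂⟩
  rintro rfl
  exact hn₁.lt.not_ge (hv.le_of_ge ⟨hnw₁, hnw₂⟩ hn₁.le)

/-- If two arrows start in a vertex, then the injective at that vertex is not projective. -/
theorem IsCovered.not_isPerfect (hV : HasChainIntervals V) (hN : IsConvexRel N)
    (hC : IsCovered N) {v n₁ n₂ c : V} (hn : n₁ ≠ n₂) (h₁ : v ⋖ n₁) (h₂ : v ⋖ n₂)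
    (hN₁ : N v n₁) (hN₂ : N v n₂) : ¬ IsPerfect N c v := by
  intro hP
  -- If `u₁ ≤ u₂`, perfectness of `(u₂, w₂)` gives `w₁ ≤ w₂`, so `n₁` and `n₂` lie in the chain from
  -- `v` to `w₂`. A perfect pair `(c, v)` makes `u₁` and `u₂` comparable, both being between `c` and
  -- `v`.
  have key : ∀ {n₁ n₂ u₁ w₁ u₂ w₂ : V}, n₁ ≠ n₂ → v ⋖ n₁ → v ⋖ n₂ → IsPerfect N u₁ w₁ →
      u₁ ≤ v → n₁ ≤ w₁ → IsPerfect N u₂ w₂ → u₂ ≤ v → n₂ ≤ w₂ → u₁ ≤ u₂ → False := by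
    intro n₁ n₂ u₁ w₁ u₂ w₂ hn h₁ h₂ hP₁ hu₁ hw₁ hP₂ hu₂ hw₂ huu
    have hww : w₁ ≤ w₂ :=
      hP₂.right w₁ (hN.mono huu (hu₂.trans (h₁.le.trans hw₁)) le_rfl hP₁.rel)
    rcases hV v w₂ n₁ n₂ h₁.le (hw₁.trans hww) h₂.le hw₂ with h | h
    · exact h₂.2 h₁.lt (lt_of_le_of_ne h hn)
    · exact h₁.2 h₂.lt (lt_of_le_of_ne h hn.symm)
  obtain ⟨u₁, w₁, hP₁, hu₁, hw₁⟩ := hC _ _ hN₁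
  obtain ⟨u₂, w₂, hP₂, hu₂, hw₂⟩ := hC _ _ hN₂
  have hc₁ : c ≤ u₁ := hP.left u₁ (hN.mono le_rfl hu₁ (h₁.le.trans hw₁) hP₁.rel)
  have hc₂ : c ≤ u₂ := hP.left u₂ (hN.mono le_rfl hu₂ (h₂.le.trans hw₂) hP₂.rel)
  rcases hV c v u₁ u₂ hc₁ hu₁ hc₂ hu₂ with h | h
  · exact key hn h₁ h₂ hP₁ hu₁ hw₁ hP₂ hu₂ hw₂ h
  · exact key hn.symm h₂ h₁ hP₂ hu₂ hw₂ hP₁ hu₁ hw₁ h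

end Perfect

/-! ### Socles of projective-injective modules and of the first cosyzygy -/

namespace PairBasis

section Modules

open scoped Classical

variable {K A V : Type*} [Field K] [Ring A] [Algebra K A] [Fintype V] [PartialOrder V]
  {N : V → V → Prop} (B : PairBasis K A N)

include B

/-- The socle of a projective-injective module is supported in the right ends of perfect pairs. -/
theorem exists_isPerfect_of_socle (hN : IsConvexRel N) {J : Type*} [AddCommGroup J] [Module A J]
    (hJ : Module.Baer A J) (hP : Module.Projective A J) {z : V} {s : J} (hs : s ≠ 0)
    (hzs : B.E z z • s = s) (hrad : ∀ d, d ≠ z → B.E z d • s = 0) :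
    ∃ c, IsPerfect N c z := by
  -- Projectivity embeds `J` into a free module; some coordinate `f` of this embedding does not kill
  -- `s`.
  obtain ⟨σ, hσ⟩ := hP.out
  have hσs : σ s ≠ 0 := fun h => hs (by rw [← hσ s, h, map_zero])
  obtain ⟨i, hi⟩ := Finsupp.ne_iff.1 hσs
  set f : J →ₗ[A] A := Finsupp.lapply i ∘ₗ σ with hf
  have hfs : f s ≠ 0 := hi
  obtain ⟨c, hcN, hc⟩ : ∃ c, N c z ∧ B.coeff c z (f s) ≠ 0 := by
    by_contra! hcon
    refine hfs (B.ext_coeff fun a b hab => ?_)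
    rw [map_zero, ← hzs, map_smul, smul_eq_mul, B.coeff_E_mul]
    split_ifs with h
    · obtain ⟨rfl, -, -⟩ := h
      exact hcon a hab
    · rfl
  -- Injectivity lets `s` be divided: `E a z • j = s` whenever `N a z`, while `E a b` kills `j` if
  -- `b` is neither `z` nor below `z`.
  obtain ⟨j, hj⟩ := B.exists_smul_eq hJ (fun _ b => ¬ b < z)
    (fun a b d hab hbd hd => hab (lt_of_le_of_lt (hN.le hbd) hd))
    (fun a b => if b = z then s else 0) (fun a b c d hb hab hcd => by
      by_cases hbz : b = z
      · subst hbz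
        rw [if_pos rfl]
        by_cases hcb : c = b
        · subst hcb
          by_cases hdc : d = c
          · subst hdc
            simp [hzs, hab]
          · rw [hrad d hdc, if_neg hdc]
            simp
        · rw [if_neg fun h => hcb h.1, ← hzs, ← mul_smul, B.mul_ne (Ne.symm hcb), zero_smul]
      · rw [if_neg hbz, smul_zero]
        by_cases hcb : c = b
        · subst hcb
          have hdz : d ≠ z := fun hdz => hb (lt_of_le_of_ne (hdz ▸ hN.le hcd) hbz)
          simp [hdz]
        · rw [if_neg fun h => hcb h.1])
  -- With `d = z` the coefficient of `f j` at `(c, x)` is non-zero, so `N c x`. If `N c y` with `y`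
  -- not below `z`, then `x = c` and `d = y` make the coefficient at `(c, c)` zero, against `d = z`.
  have hcoeff : ∀ x d, N x d → N c d → ¬ d < z →
      B.coeff c x (f j) = if d = z then B.coeff c z (f s) else 0 := fun x d hxd hcd hd => by
    have h := congrArg (fun y => B.coeff c d (f y)) (hj x d hd hxd)
    simp only [map_smul, smul_eq_mul, B.coeff_E_mul, hxd, hcd, and_self, if_true] at h
    rw [h]
    split_ifs with hdz
    · rw [hdz]
    · rw [map_zero, map_zero]
  refine ⟨c, hcN, fun x hx => ?_, fun y hy => ?_⟩
  · by_contra hcx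
    have := hcoeff x z hx hcN (lt_irrefl z)
    rw [B.coeff_eq_zero fun h => hcx (hN.le h), if_pos rfl] at this
    exact hc this.symm
  · by_contra hyz
    have h1 := hcoeff c y hy hy fun h => hyz h.le
    have h2 := hcoeff c z hcN hcN (lt_irrefl z)
    rw [if_pos rfl] at h2
    rw [h2, if_neg fun h => hyz h.le] at h1
    exact hc h1

/-- If the algebra embeds into a projective-injective module, then the relation is covered. -/
theorem isCovered_of_embedding (hN : IsConvexRel N) {J : Type*} [AddCommGroup J] [Module A J]
    (hJ : Module.Baer A J) (hP : Module.Projective A J) (ι : A →ₗ[A] J)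
    (hι : Function.Injective ι) : IsCovered N := by
  intro a b hab
  -- For maximal `z` the element `E a z` cannot be prolonged, so it lies in the socle.
  obtain ⟨z, hbz, hz⟩ := Finite.exists_le_maximal (p := fun z => N a z) hab
  have hazz : B.E z z * B.E a z = B.E a z := B.mul_self hz.prop (hN.refl z)
  obtain ⟨c, hc⟩ := B.exists_isPerfect_of_socle hN hJ hP (z := z) (s := ι (B.E a z))
    (fun h => by
      have h0 : B.E a z = 0 := hι (by rw [h, map_zero])
      have h1 := B.coeff_E_self hz.prop
      rw [h0, map_zero] at h1
      exact zero_ne_one h1)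
    (by rw [← map_smul, smul_eq_mul, hazz])
    (fun d hd => by
      rw [← map_smul, smul_eq_mul]
      by_cases hzd : N z d
      · rw [B.mul_self hz.prop hzd, B.E_eq_zero, map_zero]
        exact fun had => hd (le_antisymm (hz.le_of_ge had (hN.le hzd)) (hN.le hzd))
      · rw [B.E_eq_zero hzd, zero_mul, map_zero])
  exact ⟨c, z, hc, hc.left a hz.prop, hbz⟩

/-- If two arrows start in `v`, then the simple module at `v` embeds into the first cosyzygy. -/
theorem exists_socle_of_covBy (hV : HasChainIntervals V) (hN : IsConvexRel N) {I₀ I₁ : Type*}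
    [AddCommGroup I₀] [Module A I₀] [AddCommGroup I₁] [Module A I₁] (hI : Module.Baer A I₀)
    (ι : A →ₗ[A] I₀) (hι : Function.Injective ι) (δ : I₀ →ₗ[A] I₁)
    (hδ : LinearMap.range ι = LinearMap.ker δ) {v n₁ n₂ : V} (hn : n₁ ≠ n₂) (h₁ : v ⋖ n₁)
    (h₂ : v ⋖ n₂) (hN₁ : N v n₁) (hN₂ : N v n₂) :
    ∃ s : I₁, s ≠ 0 ∧ B.E v v • s = s ∧ ∀ d, d ≠ v → B.E v d • s = 0 := by
  have hE : ∀ d, N v d → B.E v d * B.E v v = B.E v d := fun d hd => B.mul_self (hN.refl v) hd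
  have hδι : ∀ y, δ (ι y) = 0 := fun y => by
    have : ι y ∈ LinearMap.ker δ := hδ ▸ ⟨y, rfl⟩
    exact this
  -- On paths of positive length from `v`, `j` acts like `1` on the branch through `n₁` and like `0`
  -- on the others. This is consistent because prolonging a path keeps it in its branch.
  obtain ⟨j, hj⟩ := B.exists_smul_eq hI (fun a b => a = v ∧ v < b)
    (fun a b d hab hbd => ⟨hab.1, lt_of_lt_of_le hab.2 (hN.le hbd)⟩)
    (fun a b => if n₁ ≤ b then ι (B.E a b) else 0) (fun a b c d hvb hab hcd => by
      obtain ⟨rfl, hvb⟩ := hvb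
      by_cases hcb : c = b
      · subst hcb
        have hnd : n₁ ≤ d ↔ n₁ ≤ c := by
          refine ⟨fun hd => ?_, fun hc => hc.trans (hN.le hcd)⟩
          rcases hV a d n₁ c h₁.le hd hvb.le (hN.le hcd) with h | h
          · exact h
          · exact (h₁.eq_or_eq hvb.le h).elim (fun h => absurd h hvb.ne') fun h => h.ge
        by_cases hnc : n₁ ≤ c
        · rw [if_pos hnc, ← map_smul, smul_eq_mul, B.mul_self hab hcd]
          simp only [hnd.2 hnc, if_true, true_and]
          split_ifs with had
          · rfl
          · rw [B.E_eq_zero had, map_zero]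
        · simp [hnd, hnc]
      · rw [if_neg (show ¬(c = b ∧ N a d) from fun h => hcb h.1)]
        split_ifs with h
        · rw [← map_smul, smul_eq_mul, B.mul_ne (Ne.symm hcb), map_zero]
        · rw [smul_zero])
  refine ⟨δ (B.E v v • j), fun h0 => ?_, ?_, fun d hd => ?_⟩
  -- If `E v v • j` came from `y`, the coefficient of `y` at `(v, v)` would be one because of `n₁`
  -- and zero because of `n₂`.
  · obtain ⟨y, hy⟩ : B.E v v • j ∈ LinearMap.range ι := hδ ▸ h0
    have hvd : ∀ d, v < d → N v d → ι (B.E v d * y) = if n₁ ≤ d then ι (B.E v d) else 0 :=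
      fun d hd hvd => by
        rw [← smul_eq_mul, map_smul, hy, ← mul_smul, hE d hvd, hj v d ⟨rfl, hd⟩ hvd]
    have e₁ := hvd n₁ h₁.lt hN₁
    have e₂ := hvd n₂ h₂.lt hN₂
    rw [if_pos le_rfl] at e₁
    rw [if_neg fun h => (h₂.eq_or_eq h₁.le h).elim (fun h => h₁.lt.ne' h) hn, ← map_zero ι] at e₂
    have f₁ := congrArg (B.coeff v n₁) (hι e₁)
    have f₂ := congrArg (B.coeff v n₂) (hι e₂)
    rw [B.coeff_E_mul, if_pos ⟨rfl, hN₁, hN₁⟩, B.coeff_E_self hN₁] at f₁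
    rw [B.coeff_E_mul, if_pos ⟨rfl, hN₂, hN₂⟩, map_zero, f₁] at f₂
    exact one_ne_zero f₂
  · rw [← map_smul, ← mul_smul, hE v (hN.refl v)]
  · by_cases hvd : N v d
    · rw [← map_smul, ← mul_smul, hE d hvd,
        hj v d ⟨rfl, lt_of_le_of_ne (hN.le hvd) hd.symm⟩ hvd]
      split_ifs
      · exact hδι _
      · exact map_zero _
    · rw [B.E_eq_zero hvd, zero_smul]

end Modules

end PairBasis

/-! ### Dominant dimension in terms of perfect pairs -/

namespace PairBasis

section ProjectiveInjective

open scoped Classical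

variable {K A V : Type*} [Field K] [Ring A] [Algebra K A] [Fintype V] {N : V → V → Prop}
  (B : PairBasis K A N)

/-- The left ideal generated by the idempotent `E u u`. -/
def proj (u : V) : Submodule A A where
  carrier := {x | x * B.E u u = x}
  add_mem' {x y} hx hy := by
    change (x + y) * _ = _
    rw [add_mul, hx, hy]
  zero_mem' := zero_mul _
  smul_mem' r x hx := by
    change r * x * _ = r * x
    rw [mul_assoc, hx]

theorem coeff_of_mem_proj {u : V} {x : A} (hx : x ∈ B.proj u) {a : V} (ha : a ≠ u) (b : V) :
    B.coeff a b x = 0 := by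
  rw [← (show x * B.E u u = x from hx), B.coeff_mul_E, if_neg fun h => ha h.1]

variable [PartialOrder V]

theorem E_mem_proj (hN : IsConvexRel N) (u y : V) : B.E u y ∈ B.proj u := by
  change B.E u y * B.E u u = B.E u y
  by_cases h : N u y
  · exact B.mul_self (hN.refl u) h
  · rw [B.E_eq_zero h, zero_mul]

theorem projective_proj (hN : IsConvexRel N) (u : V) : Module.Projective A (B.proj u) := by
  refine Module.Projective.of_split (B.proj u).subtype
    ((LinearMap.toSpanSingleton A A (B.E u u)).codRestrict (B.proj u)
      fun x => (B.proj u).smul_mem x (B.E_mem_proj hN u u)) ?_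
  ext x
  exact x.2

/-- The left projective at `u` is injective if `(u, w)` is a perfect pair for some `w`. -/
theorem baer_proj (hN : IsConvexRel N) {u w : V} (hP : IsPerfect N u w) :
    Module.Baer A (B.proj u) := by
  intro I g
  -- An element of the projective at `u` is determined by the `(u, w)` coefficients of its multiples
  -- by the `E b w`. So `g` is encoded in a functional on `I`; `φ` extends it linearly to `A`, and
  -- right multiplication by `p` realises `φ`.
  obtain ⟨ψ, hψ⟩ := LinearMap.exists_leftInverse_of_injective (I.subtype.restrictScalars K)
    (LinearMap.ker_eq_bot.2 Subtype.val_injective)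
  set φ : A →ₗ[K] K := B.coeff u w ∘ₗ ((B.proj u).subtype ∘ₗ g).restrictScalars K ∘ₗ ψ with hφ
  have hφI : ∀ x (hx : x ∈ I), φ x = B.coeff u w (g ⟨x, hx⟩) := fun x hx =>
    congrArg (fun y : I => B.coeff u w (g y)) (LinearMap.congr_fun hψ ⟨x, hx⟩)
  set p : A := ∑ y, φ (B.E y w) • B.E u y with hp
  have hpu : p ∈ B.proj u := Submodule.sum_mem _ fun y _ => by
    rw [Algebra.smul_def]
    exact (B.proj u).smul_mem _ (B.E_mem_proj hN u y)
  have hcp : ∀ a, N u a → B.coeff u a p = φ (B.E a w) := fun a ha => by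
    rw [hp, map_sum, Finset.sum_eq_single a]
    · rw [map_smul, B.coeff_E_self ha, smul_eq_mul, mul_one]
    · intro b _ hb
      rw [map_smul, B.coeff_E, if_neg fun h => hb h.2.1.symm, smul_zero]
    · simp
  refine ⟨(LinearMap.toSpanSingleton A (B.proj u) ⟨p, hpu⟩), fun x hx => ?_⟩
  rw [LinearMap.toSpanSingleton_apply]
  refine Subtype.ext (B.ext_coeff fun a b hab => ?_)
  change B.coeff a b (x * p) = _
  by_cases hau : a = u
  · subst hau
    have hbw : N b w := hN.mono (hN.le hab) (hP.right b hab) le_rfl hP.rel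
    have hlin : B.coeff a w ∘ₗ LinearMap.mulRight K p ∘ₗ LinearMap.mulLeft K (B.E b w) =
        φ ∘ₗ LinearMap.mulLeft K (B.E b w) := B.hom_ext fun c d hcd => by
      simp only [LinearMap.comp_apply, LinearMap.mulLeft_apply, LinearMap.mulRight_apply]
      by_cases hdb : d = b
      · subst hdb
        rw [B.mul_self hcd hbw]
        by_cases hcw : N c w
        · have hac : N a c := hN.mono le_rfl (hP.left c hcw) (hN.le hcw) hP.rel
          rw [B.coeff_E_mul, if_pos ⟨rfl, hcw, hP.rel⟩, hcp c hac]
        · simp [B.E_eq_zero hcw]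
      · simp [B.mul_ne hdb]
    have h1 := LinearMap.congr_fun hlin x
    simp only [LinearMap.comp_apply, LinearMap.mulLeft_apply, LinearMap.mulRight_apply] at h1
    rw [hφI _ (I.mul_mem_left _ hx), mul_assoc, B.coeff_E_mul, if_pos ⟨rfl, hbw, hP.rel⟩] at h1
    rw [h1, show (⟨B.E b w * x, I.mul_mem_left _ hx⟩ : I) = B.E b w • ⟨x, hx⟩ from rfl, map_smul]
    change B.coeff a w (B.E b w * _) = _
    rw [B.coeff_E_mul, if_pos ⟨rfl, hbw, hP.rel⟩]
  · rw [B.coeff_of_mem_proj (g ⟨x, hx⟩).2 hau]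
    exact B.coeff_of_mem_proj ((B.proj u).smul_mem x hpu) hau b

end ProjectiveInjective

section DominantDimension

open scoped Classical

variable {K : Type w} {V : Type v} {A : Type u} [Field K] [Ring A] [Algebra K A]
  [Fintype V] [PartialOrder V] {N : V → V → Prop} (B : PairBasis K A N)

include B

theorem domDimAtLeast_one_of_isCovered (hN : IsConvexRel N) (hC : IsCovered N) :
    DomDimAtLeast A A 1 := by
  -- Indexing by `Fin` keeps the product in the universe of `A`. The factor of `(u, a)` receives `x
  -- * E u a`, which retains the coefficients of `x` at those `(a, b)` for which `(u, b)` is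
  -- related.
  let e := (Fintype.equivFin {p : V × V // ∃ w, IsPerfect N p.1 w}).symm
  let J : Type u := ∀ i, B.proj (e i).1.1
  have hinj : ∀ i, Module.Injective A (B.proj (e i).1.1) := fun i =>
    (B.baer_proj hN (e i).2.choose_spec).injective
  have hproj : ∀ i, Module.Projective A (B.proj (e i).1.1) := fun i => B.projective_proj hN _
  have hJp : Module.Projective A J := Module.Projective.of_equiv
    (DFinsupp.linearEquivFunOnFintype (R := A) (M := fun i => B.proj (e i).1.1))
  let f : A →ₗ[A] J := LinearMap.pi fun i =>
    (LinearMap.toSpanSingleton A A (B.E (e i).1.1 (e i).1.2)).codRestrict (B.proj (e i).1.1)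
      fun x => (B.proj (e i).1.1).smul_mem x (B.E_mem_proj hN (e i).1.1 (e i).1.2)
  refine domDimAtLeast_one (J := J) (Module.Injective.pi A _) hJp f ?_
  rw [← LinearMap.ker_eq_bot, eq_bot_iff]
  intro x hx
  refine B.ext_coeff fun a b hab => ?_
  obtain ⟨z, w, hP, hza, hbw⟩ := hC a b hab
  have h : x * B.E z a = 0 := by
    have h := congrArg Subtype.val (congrFun hx (e.symm ⟨(z, a), w, hP⟩))
    change x * B.E (e (e.symm _)).1.1 (e (e.symm _)).1.2 = 0 at h
    rwa [e.apply_symm_apply] at h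
  have h1 := B.coeff_mul_E z b z a x
  rw [h, map_zero, if_pos ⟨rfl, hN.mono le_rfl hza ((hN.le hab).trans hbw) hP.rel,
    hN.mono le_rfl (hza.trans (hN.le hab)) hbw hP.rel⟩] at h1
  rw [← h1, map_zero]

theorem isCovered_of_domDimAtLeast_one (hN : IsConvexRel N) (h : DomDimAtLeast A A 1) :
    IsCovered N := by
  obtain ⟨R, hR⟩ := h
  exact B.isCovered_of_embedding hN (Module.Baer.of_injective (R.injective 0)) (hR 0 one_pos)
    R.ι R.ι_injective

theorem not_domDimAtLeast_two (hV : HasChainIntervals V) (hN : IsConvexRel N) {v n₁ n₂ : V}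
    (hn : n₁ ≠ n₂) (h₁ : v ⋖ n₁) (h₂ : v ⋖ n₂) (hN₁ : N v n₁) (hN₂ : N v n₂) :
    ¬ DomDimAtLeast A A 2 := by
  intro h
  have hC := B.isCovered_of_domDimAtLeast_one hN (h.mono one_le_two)
  obtain ⟨R, hR⟩ := h
  obtain ⟨s, hs, hvs, hrad⟩ := B.exists_socle_of_covBy hV hN
    (Module.Baer.of_injective (R.injective 0)) R.ι R.ι_injective (R.d 0) R.exact_zero hn
    h₁ h₂ hN₁ hN₂
  obtain ⟨c, hc⟩ := B.exists_isPerfect_of_socle hN (Module.Baer.of_injective (R.injective 1))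
    (hR 1 one_lt_two) hs hvs hrad
  exact hC.not_isPerfect hV hN hn h₁ h₂ hN₁ hN₂ hc

theorem domDim_eq_zero_iff (hN : IsConvexRel N) : domDim A = 0 ↔ ¬ IsCovered N := by
  rw [TreeAlgebra.domDim_eq_zero_iff, not_iff_not]
  exact ⟨B.isCovered_of_domDimAtLeast_one hN, B.domDimAtLeast_one_of_isCovered hN⟩

/-- The dominant dimension is at most one in the presence of a branching vertex. -/
theorem domDim_eq_ite (hV : HasChainIntervals V) (hN : IsConvexRel N) {z x₁ x₂ : V} (hx : x₁ ≠ x₂)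
    (h : (z ⋖ x₁ ∧ z ⋖ x₂ ∧ N z x₁ ∧ N z x₂) ∨ (x₁ ⋖ z ∧ x₂ ⋖ z ∧ N x₁ z ∧ N x₂ z)) :
    domDim A = if IsCovered N then 1 else 0 := by
  split_ifs with hC
  · refine domDim_eq_one (B.domDimAtLeast_one_of_isCovered hN hC) ?_
    rcases h with ⟨h₁, h₂, hN₁, hN₂⟩ | ⟨h₁, h₂, hN₁, hN₂⟩
    · exact B.not_domDimAtLeast_two hV hN hx h₁ h₂ hN₁ hN₂
    · obtain ⟨v, n₁, n₂, hn, h₁, h₂, hN₁, hN₂⟩ := hC.exists_covBy hV hN hx h₁ h₂ hN₁ hN₂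
      exact B.not_domDimAtLeast_two hV hN hn h₁ h₂ hN₁ hN₂
  · exact (B.domDim_eq_zero_iff hN).2 hC

end DominantDimension

end PairBasis

/-! ### Restricting and extending coverings along arms -/

section Arms

variable {V : Type*} [PartialOrder V]

/-- The vertex `b` ends a left arm: the vertices below `b` form a chain without branching, and
those strictly below `b` are dropped. -/
structure IsLeftEnd (D : V → Prop) (b : V) : Prop where
  kept : ¬ D b
  exists_le : ∃ a, ∀ y ≤ b, a ≤ y
  dropped : ∀ y ≤ b, y ≠ b → D y
  le_or_le : ∀ y z, y ≤ b → y ≤ z → z ≤ b ∨ b ≤ z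

/-- The vertex `c` starts a right arm: the vertices above `c` form a chain without branching, and
those strictly above `c` are dropped. -/
structure IsRightEnd (D : V → Prop) (c : V) : Prop where
  kept : ¬ D c
  exists_ge : ∃ d, ∀ y, c ≤ y → y ≤ d
  dropped : ∀ y, c ≤ y → y ≠ c → D y
  le_or_le : ∀ y z, c ≤ y → z ≤ y → z ≤ c ∨ c ≤ z

theorem IsLeftEnd.eq_of_le {D : V → Prop} {b y : V} (hb : IsLeftEnd D b) (hy : ¬ D y)
    (h : y ≤ b) : y = b :=
  by_contra fun hne => hy (hb.dropped y h hne)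

theorem IsRightEnd.eq_of_le {D : V → Prop} {c y : V} (hc : IsRightEnd D c) (hy : ¬ D y)
    (h : c ≤ y) : y = c :=
  by_contra fun hne => hy (hc.dropped y h hne)

/-- The dropped vertices are those in the left and right arms that are not the ends next to
branching vertices. -/
def IsArmed (D : V → Prop) : Prop :=
  ∀ x, D x → (∃ b, x ≤ b ∧ IsLeftEnd D b) ∨ (∃ c, c ≤ x ∧ IsRightEnd D c)

theorem IsLeftEnd.le_of_le {D : V → Prop} {b x y : V} (hb : IsLeftEnd D b) (hy : ¬ D y)
    (hxb : x ≤ b) (hxy : x ≤ y) : b ≤ y :=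
  (hb.le_or_le x y hxb hxy).elim (fun h => (hb.eq_of_le hy h).ge) id

theorem IsRightEnd.le_of_le {D : V → Prop} {c x y : V} (hc : IsRightEnd D c) (hy : ¬ D y)
    (hxc : c ≤ x) (hyx : y ≤ x) : y ≤ c :=
  (hc.le_or_le x y hxc hyx).elim id fun h => (hc.eq_of_le hy h).le

/-- Below the end of a left arm nothing else is kept, so a dropped vertex above a kept one lies on a
right arm, and the kept vertex lies below the start of that arm. -/
theorem IsArmed.exists_right_of_kept_le {D : V → Prop} (hD : IsArmed D) {b w : V} (hb : ¬ D b)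
    (hbw : b ≤ w) (hw : D w) : ∃ c, b ≤ c ∧ c ≤ w ∧ IsRightEnd D c := by
  rcases hD w hw with ⟨e, hwe, he⟩ | ⟨c, hcw, hc⟩
  · obtain rfl := he.eq_of_le hb (hbw.trans hwe)
    exact absurd hw (le_antisymm hwe hbw ▸ hb)
  · exact ⟨c, hc.le_of_le hb hcw hbw, hcw, hc⟩

theorem IsArmed.exists_left_of_le_kept {D : V → Prop} (hD : IsArmed D) {a u : V} (ha : ¬ D a)
    (hua : u ≤ a) (hu : D u) : ∃ c, u ≤ c ∧ c ≤ a ∧ IsLeftEnd D c := by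
  rcases hD u hu with ⟨e, hue, he⟩ | ⟨c, hcu, hc⟩
  · exact ⟨e, hue, he.le_of_le ha hue hua, he⟩
  · obtain rfl := hc.eq_of_le ha (hcu.trans hua)
    exact absurd hu (le_antisymm hua hcu ▸ ha)

section Restrict

variable {D : V → Prop} {N : V → V → Prop}

/-- Take perfect pairs `(u, w)` around `(a, b)` and `(u₂, w₂)` around `(x, b)`. Either `w` is kept
and equals `b`, or maximality makes `b` the start of a right arm, a chain; in both cases `w` and
`w₂` are comparable. Perfectness then puts `a` and `x` in one chain ending in `b`, and `hmin`
decides their order. -/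
theorem IsCovered.le_of_maximal (hV : HasChainIntervals V) (hD : IsArmed D) (hN : IsConvexRel N)
    (hC : IsCovered N) {a b x : V} (hb : ¬ D b) (hab : N a b)
    (hmin : ∀ y, ¬ D y → y ≤ a → N y b → y = a) (hmax : ∀ y, ¬ D y → b ≤ y → N a y → y = b)
    (hx : ¬ D x) (hxb : N x b) : a ≤ x := by
  obtain ⟨u, w, hP, hua, hbw⟩ := hC a b hab
  obtain ⟨u₂, w₂, hP₂, hux, hbw₂⟩ := hC x b hxb
  have hxle := hN.le hxb
  have hale := hN.le hab
  have hw : w ≤ w₂ ∨ w₂ ≤ w := by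
    by_cases hDw : D w
    · obtain ⟨c, hbc, hcw, hc⟩ := hD.exists_right_of_kept_le hb hbw hDw
      obtain rfl := hmax c hc.kept hbc (hN.mono hua (hale.trans hbc) hcw hP.rel)
      obtain ⟨d, hd⟩ := hc.exists_ge
      exact hV c d w w₂ hbw (hd w hbw) hbw₂ (hd w₂ hbw₂)
    · exact Or.inl (hmax w hDw hbw (hN.mono hua (hale.trans hbw) le_rfl hP.rel) ▸ hbw₂)
  have key : a ≤ x ∨ x ≤ a := by
    rcases hw with h | h
    · exact hV u b a x hua hale (hP.left x (hN.mono hux (hxle.trans hbw) h hP₂.rel)) hxle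
    · have hu : u₂ ≤ u := hP₂.left u (hN.mono le_rfl (hua.trans (hale.trans hbw₂)) h hP.rel)
      exact hV u₂ b a x (hu.trans hua) hale hux hxle
  exact key.elim id fun h => (hmin x hx h hxb).ge

/-- The mirror image, comparing the left ends `u` and `u₂` along a left arm. -/
theorem IsCovered.ge_of_maximal (hV : HasChainIntervals V) (hD : IsArmed D) (hN : IsConvexRel N)
    (hC : IsCovered N) {a b x : V} (ha : ¬ D a) (hab : N a b)
    (hmin : ∀ y, ¬ D y → y ≤ a → N y b → y = a) (hmax : ∀ y, ¬ D y → b ≤ y → N a y → y = b)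
    (hx : ¬ D x) (hax : N a x) : x ≤ b := by
  obtain ⟨u, w, hP, hua, hbw⟩ := hC a b hab
  obtain ⟨u₂, w₂, hP₂, hua₂, hxw⟩ := hC a x hax
  have hxle := hN.le hax
  have hale := hN.le hab
  have hu : u ≤ u₂ ∨ u₂ ≤ u := by
    by_cases hDu : D u
    · obtain ⟨c, huc, hca, hc⟩ := hD.exists_left_of_le_kept ha hua hDu
      obtain rfl := hmin c hc.kept hca (hN.mono huc (hca.trans hale) hbw hP.rel)
      obtain ⟨d, hd⟩ := hc.exists_le
      exact hV d c u u₂ (hd u hua) hua (hd u₂ hua₂) hua₂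
    · exact Or.inr (hmin u hDu hua (hN.mono le_rfl (hua.trans hale) hbw hP.rel) ▸ hua₂)
  have key : x ≤ b ∨ b ≤ x := by
    rcases hu with h | h
    · have hw : w ≤ w₂ := hP₂.right w (hN.mono h (hua₂.trans (hale.trans hbw)) le_rfl hP.rel)
      exact hV a w₂ x b hxle hxw hale (hbw.trans hw)
    · exact hV a w x b hxle (hP.right x (hN.mono h (hua.trans hxle) hxw hP₂.rel)) hale hbw
  exact key.elim id fun h => (hmax x hx h hax).le

/-- A pair of kept vertices that cannot be enlarged at either end within the kept vertices is
perfect there, and every related pair of kept vertices lies in such a pair. -/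
theorem IsCovered.restrict [Finite V] (hV : HasChainIntervals V) (hD : IsArmed D)
    (hN : IsConvexRel N) (hC : IsCovered N) :
    IsCovered fun a b : {x : V // ¬ D x} => N a b := by
  intro a₀ b₀ hab₀
  obtain ⟨a, haa, ha⟩ := Finite.exists_le_minimal (p := fun a : {x : V // ¬ D x} => N a b₀) hab₀
  obtain ⟨b, hbb, hb⟩ := Finite.exists_le_maximal (p := fun b : {x : V // ¬ D x} => N a b) ha.prop
  have hmin : ∀ y, ¬ D y → y ≤ a → N y b → y = a := fun y hy hya hyb =>
    congrArg Subtype.val (le_antisymm (a := (⟨y, hy⟩ : {x : V // ¬ D x})) hya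
      (ha.le_of_le (hN.mono le_rfl (hya.trans (hN.le ha.prop)) hbb hyb) hya))
  have hmax : ∀ y, ¬ D y → b ≤ y → N a y → y = b := fun y hy hby hay =>
    congrArg Subtype.val (le_antisymm (a := (⟨y, hy⟩ : {x : V // ¬ D x})) (hb.le_of_ge hay hby) hby)
  exact ⟨a, b, ⟨hb.prop, fun x hx => hC.le_of_maximal hV hD hN b.2 hb.prop hmin hmax x.2 hx,
    fun y hy => hC.ge_of_maximal hV hD hN a.2 hb.prop hmin hmax y.2 hy⟩, haa, hbb⟩

end Restrict

section Extend

variable {D : V → Prop}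

/-- The vertex `r` is obtained from `x` by contracting the arms. -/
def IsContraction (D : V → Prop) (x r : V) : Prop :=
  (¬ D x ∧ x = r) ∨ (x ≤ r ∧ IsLeftEnd D r) ∨ (r ≤ x ∧ IsRightEnd D r)

theorem IsArmed.exists_isContraction (hD : IsArmed D) (x : V) : ∃ r, IsContraction D x r := by
  by_cases hx : D x
  · rcases hD x hx with ⟨b, h⟩ | ⟨c, h⟩
    · exact ⟨b, Or.inr (Or.inl h)⟩
    · exact ⟨c, Or.inr (Or.inr h)⟩
  · exact ⟨x, Or.inl ⟨hx, rfl⟩⟩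

namespace IsContraction

theorem kept {x r : V} (h : IsContraction D x r) : ¬ D r := by
  rcases h with ⟨h, rfl⟩ | ⟨-, h⟩ | ⟨-, h⟩
  exacts [h, h.kept, h.kept]

theorem le_of_le {x y r : V} (h : IsContraction D x r) (hy : ¬ D y) (hxy : x ≤ y) : r ≤ y := by
  rcases h with ⟨h, rfl⟩ | ⟨hxr, h⟩ | ⟨hrx, h⟩
  exacts [hxy, h.le_of_le hy hxr hxy, hrx.trans hxy]

theorem ge_of_ge {x y r : V} (h : IsContraction D x r) (hy : ¬ D y) (hxy : y ≤ x) : y ≤ r := by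
  rcases h with ⟨h, rfl⟩ | ⟨hxr, h⟩ | ⟨hrx, h⟩
  exacts [hxy, hxy.trans hxr, h.le_of_le hy hrx hxy]

theorem mono {x y r s : V} (hx : IsContraction D x r) (hy : IsContraction D y s) (hxy : x ≤ y) :
    r ≤ s := by
  rcases hx with ⟨h, rfl⟩ | ⟨hxr, h⟩ | ⟨hrx, h⟩
  · exact hy.ge_of_ge h hxy
  · rcases h.le_or_le x y hxr hxy with hyr | hry
    · exact (h.eq_of_le hy.kept (hy.le_of_le h.kept hyr)).ge
    · exact hy.ge_of_ge h.kept hry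
  · exact hy.ge_of_ge h.kept (hrx.trans hxy)

/-- Contraction lowers a vertex only on a right arm, and there `r ≤ c < d` would give two kept
vertices above the start. Hence the strict inequality. -/
theorem le_of_lt {x r c d : V} (h : IsContraction D x r) (hc : ¬ D c) (hd : ¬ D d) (hrc : r ≤ c)
    (hcd : c < d) : x ≤ c := by
  rcases h with ⟨h, rfl⟩ | ⟨hxr, h⟩ | ⟨hrx, h⟩
  · exact hrc
  · exact hxr.trans hrc
  · exact absurd ((h.eq_of_le hc hrc).trans (h.eq_of_le hd (hrc.trans hcd.le)).symm) hcd.ne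

theorem ge_of_lt {x r c d : V} (h : IsContraction D x r) (hc : ¬ D c) (hd : ¬ D d) (hdr : d ≤ r)
    (hcd : c < d) : d ≤ x := by
  rcases h with ⟨h, rfl⟩ | ⟨hxr, h⟩ | ⟨hrx, h⟩
  · exact hdr
  · exact absurd ((h.eq_of_le hc (hcd.le.trans hdr)).trans (h.eq_of_le hd hdr).symm) hcd.ne
  · exact hdr.trans hrx

end IsContraction

/-- The left adjoint of the contraction of arms. -/
theorem exists_left_extension (u' : V) (hu' : ¬ D u') :
    ∃ u ≤ u', (∀ x r, IsContraction D x r → u' ≤ r → u ≤ x) ∧ ∀ c, ¬ D c → u ≤ c → u' ≤ c := by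
  by_cases hL : IsLeftEnd D u'
  · obtain ⟨a, ha⟩ := hL.exists_le
    refine ⟨a, ha u' le_rfl, ?_, fun c hc hac => hL.le_of_le hc (ha u' le_rfl) hac⟩
    rintro x r (⟨h, rfl⟩ | ⟨hxr, h⟩ | ⟨hrx, h⟩) hur
    · exact (ha u' le_rfl).trans hur
    · obtain rfl := h.eq_of_le hu' hur
      exact ha x hxr
    · exact (ha u' le_rfl).trans (hur.trans hrx)
  · refine ⟨u', le_rfl, ?_, fun c _ hc => hc⟩
    rintro x r (⟨h, rfl⟩ | ⟨hxr, h⟩ | ⟨hrx, h⟩) hur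
    · exact hur
    · exact absurd (h.eq_of_le hu' hur ▸ h) hL
    · exact hur.trans hrx

/-- The right adjoint of the contraction of arms. -/
theorem exists_right_extension (w' : V) (hw' : ¬ D w') :
    ∃ w, w' ≤ w ∧ (∀ x r, IsContraction D x r → r ≤ w' → x ≤ w) ∧
      ∀ c, ¬ D c → c ≤ w → c ≤ w' := by
  by_cases hR : IsRightEnd D w'
  · obtain ⟨d, hd⟩ := hR.exists_ge
    refine ⟨d, hd w' le_rfl, ?_, fun c hc hcd => hR.le_of_le hc (hd w' le_rfl) hcd⟩
    rintro x r (⟨h, rfl⟩ | ⟨hxr, h⟩ | ⟨hrx, h⟩) hrw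
    · exact hrw.trans (hd w' le_rfl)
    · exact (hxr.trans hrw).trans (hd w' le_rfl)
    · obtain rfl := h.eq_of_le hw' hrw
      exact hd x hrx
  · refine ⟨w', le_rfl, ?_, fun c _ hc => hc⟩
    rintro x r (⟨h, rfl⟩ | ⟨hxr, h⟩ | ⟨hrx, h⟩) hrw
    · exact hrw
    · exact hxr.trans hrw
    · exact absurd (h.eq_of_le hw' hrw ▸ h) hR

/-- The pairs `a ≤ b` such that the interval from `a` to `b` contains none of the intervals in
`r`. -/
def Avoids (r : V → V → Prop) (a b : V) : Prop :=
  a ≤ b ∧ ∀ c d, r c d → ¬ (a ≤ c ∧ d ≤ b)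

theorem isConvexRel_avoids {r : V → V → Prop} (hr : ∀ c d, r c d → c < d) :
    IsConvexRel (Avoids r) where
  le h := h.1
  refl _ := ⟨le_rfl, fun c d h hcd => (hr c d h).not_ge (hcd.2.trans hcd.1)⟩
  mono hac hcd hdb h := ⟨hcd, fun e f hef hh => h.2 e f hef ⟨hac.trans hh.1, hh.2.trans hdb⟩⟩

/-- Relations have distinct kept endpoints, so an interval avoiding them still does after
contraction of its ends. The perfect pair `(u', w')` around the contracted pair is stretched to `(u,
w)` by the adjoints, which creates no new relation inside. -/
theorem IsCovered.extend (hD : IsArmed D) {r : V → V → Prop} (hr : ∀ c d, r c d → c < d)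
    (hrD : ∀ c d, r c d → ¬ D c ∧ ¬ D d)
    (hC : IsCovered fun a b : {x : V // ¬ D x} => Avoids r a b) : IsCovered (Avoids r) := by
  intro a b hab
  obtain ⟨a', ha⟩ := hD.exists_isContraction a
  obtain ⟨b', hb⟩ := hD.exists_isContraction b
  obtain ⟨⟨u', hu'⟩, ⟨w', hw'⟩, ⟨hrel, hleft, hright⟩, hua : u' ≤ a', hbw : b' ≤ w'⟩ :=
    hC ⟨a', ha.kept⟩ ⟨b', hb.kept⟩ ⟨ha.mono hb hab.1, fun c d hcd h =>
      hab.2 c d hcd ⟨ha.le_of_lt (hrD c d hcd).1 (hrD c d hcd).2 h.1 (hr c d hcd),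
        hb.ge_of_lt (hrD c d hcd).1 (hrD c d hcd).2 h.2 (hr c d hcd)⟩⟩
  obtain ⟨u, huu, hux, huc⟩ := exists_left_extension u' hu'
  obtain ⟨w, hww, hxw, hcw⟩ := exists_right_extension w' hw'
  refine ⟨u, w, ⟨⟨huu.trans (hrel.1.trans hww), fun c d hcd h => hrel.2 c d hcd
    ⟨huc c (hrD c d hcd).1 h.1, hcw d (hrD c d hcd).2 h.2⟩⟩, fun x hx => ?_, fun y hy => ?_⟩,
    hux a a' ha hua, hxw b b' hb hbw⟩
  · obtain ⟨x', hx'⟩ := hD.exists_isContraction x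
    refine hux x x' hx' (hleft ⟨x', hx'.kept⟩ ⟨?_, fun c d hcd h => hx.2 c d hcd
      ⟨hx'.le_of_lt (hrD c d hcd).1 (hrD c d hcd).2 h.1 (hr c d hcd), h.2.trans hww⟩⟩)
    -- Although `w` may be the far end of a right arm, contractions of vertices below it stay below
    -- `w'`.
    change x' ≤ w'
    rcases id hx' with ⟨h, rfl⟩ | ⟨hxr, h⟩ | ⟨hrx, h⟩
    · exact hcw x h hx.1
    · rcases h.le_or_le x w hxr hx.1 with h' | h'
      · exact (h.eq_of_le hw' (hww.trans h')).ge
      · exact hcw x' h.kept h'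
    · exact hcw x' h.kept (hrx.trans hx.1)
  · obtain ⟨y', hy'⟩ := hD.exists_isContraction y
    refine hxw y y' hy' (hright ⟨y', hy'.kept⟩ ⟨?_, fun c d hcd h => hy.2 c d hcd
      ⟨huu.trans h.1, hy'.ge_of_lt (hrD c d hcd).1 (hrD c d hcd).2 h.2 (hr c d hcd)⟩⟩)
    change u' ≤ y'
    rcases id hy' with ⟨h, rfl⟩ | ⟨hyr, h⟩ | ⟨hry, h⟩
    · exact huc y h hy.1
    · exact huc y' h.kept (hy.1.trans hyr)
    · rcases h.le_or_le y u hry hy.1 with h' | h'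
      · exact huc y' h.kept h'
      · exact (h.eq_of_le hu' (h'.trans huu)).le

end Extend

end Arms

/-! ### Trees as posets, and their arms -/

section Tree

variable {V : Type u} [Quiver.{v} V]

theorem IsTree.adj (hQ : IsTree V) {a b : V} (e : a ⟶ b) :
    (SimpleGraph.fromRel fun a b : V => Nonempty (a ⟶ b)).Adj a b := by
  rw [SimpleGraph.fromRel_adj]
  refine ⟨?_, Or.inl ⟨e⟩⟩
  rintro rfl
  exact (hQ.asymm a a ⟨e⟩).elim e

/-- The walk in the underlying graph along a path of the quiver. -/
def IsTree.walk (hQ : IsTree V) {a : V} : ∀ {b : V}, Quiver.Path a b →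
    (SimpleGraph.fromRel fun a b : V => Nonempty (a ⟶ b)).Walk a b
  | _, .nil => .nil
  | _, .cons p e => (hQ.walk p).concat (hQ.adj e)

theorem IsTree.walk_injective (hQ : IsTree V) {a b : V} :
    Function.Injective (hQ.walk : Quiver.Path a b → _) := by
  intro p
  induction p with
  | nil =>
    intro q h
    cases q with
    | nil => rfl
    | cons q e => exact absurd h.symm (SimpleGraph.Walk.concat_ne_nil _ _)
  | @cons x b p e ih =>
    intro q h
    cases q with
    | nil => exact absurd h (SimpleGraph.Walk.concat_ne_nil _ _)
    | @cons x' _ q e' =>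
      obtain ⟨hx, hp⟩ := SimpleGraph.Walk.concat_inj h
      subst hx
      have := hQ.subsingleton_hom x b
      rw [ih hp, Subsingleton.elim e e']

/-- In an acyclic graph a walk without immediate backtracking is a path. Backtracking along arrows
would need a loop or a pair of opposite arrows. -/
theorem IsTree.isPath_walk (hQ : IsTree V) {a b : V} (p : Quiver.Path a b) :
    (hQ.walk p).IsPath := by
  classical
  rw [hQ.graph_isTree.isAcyclic.isPath_iff_isChain]
  induction p with
  | nil => exact List.isChain_nil
  | @cons x b p e ih =>
    simp only [IsTree.walk, SimpleGraph.Walk.edges_concat, List.concat_eq_append]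
    refine List.isChain_append.2 ⟨ih, List.isChain_singleton _, ?_⟩
    cases p with
    | nil => simp [IsTree.walk]
    | @cons y _ p e' =>
      simp only [IsTree.walk, SimpleGraph.Walk.edges_concat, List.concat_eq_append,
        List.getLast?_append, List.getLast?_singleton, Option.some_or, Option.mem_some_iff,
        List.head?_cons, forall_eq']
      intro h
      rcases Sym2.eq_iff.1 h with ⟨h₁, -⟩ | ⟨h₁, -⟩
      · exact (hQ.adj e').ne h₁
      · subst h₁
        exact (hQ.asymm _ _ ⟨e⟩).elim e'

theorem IsTree.subsingleton_path (hQ : IsTree V) (a b : V) : Subsingleton (Quiver.Path a b) :=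
  ⟨fun p q => hQ.walk_injective (by
    have := hQ.graph_isTree.isAcyclic.subsingleton_path a b
    exact congrArg Subtype.val (Subsingleton.elim
      (⟨_, hQ.isPath_walk p⟩ : SimpleGraph.Path _ a b) ⟨_, hQ.isPath_walk q⟩))⟩

/-- The order of the vertices of a quiver with at most one path between two vertices. -/
@[reducible]
def pathOrder (h : ∀ a b : V, Subsingleton (Quiver.Path a b)) : PartialOrder V where
  le a b := Nonempty (Quiver.Path a b)
  le_refl _ := ⟨.nil⟩
  le_trans _ _ _ := fun ⟨p⟩ ⟨q⟩ => ⟨p.comp q⟩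
  le_antisymm a b := fun ⟨p⟩ ⟨q⟩ => by
    have := h a a
    have hpq := congrArg Quiver.Path.length (Subsingleton.elim (p.comp q) .nil)
    rw [Quiver.Path.length_comp, Quiver.Path.length_nil] at hpq
    exact p.eq_of_length_zero (by omega)

variable (V) in
/-- There is at most one path between two vertices, and the order is given by the existence of
a path. -/
structure IsPathOrder [PartialOrder V] : Prop where
  le_iff : ∀ {a b : V}, a ≤ b ↔ Nonempty (Quiver.Path a b)
  subsingleton : ∀ a b : V, Subsingleton (Quiver.Path a b)

namespace IsPathOrder

variable [PartialOrder V] (h : IsPathOrder V)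

include h

theorem le_of_hom {a b : V} (e : a ⟶ b) : a ≤ b := h.le_iff.2 ⟨e.toPath⟩

theorem length_eq_zero {a : V} (p : Quiver.Path a a) : p.length = 0 := by
  have := h.subsingleton a a
  rw [Subsingleton.elim p .nil, Quiver.Path.length_nil]

theorem lt_of_length_pos {a b : V} (p : Quiver.Path a b) (hp : 0 < p.length) : a < b := by
  refine lt_of_le_of_ne (h.le_iff.2 ⟨p⟩) ?_
  rintro rfl
  exact hp.ne' (h.length_eq_zero p)

theorem covBy_of_hom {a b : V} (e : a ⟶ b) : a ⋖ b := by
  refine ⟨h.lt_of_length_pos e.toPath one_pos, fun c hac hcb => ?_⟩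
  obtain ⟨p⟩ := h.le_iff.1 hac.le
  obtain ⟨q⟩ := h.le_iff.1 hcb.le
  have := h.subsingleton a b
  have hpq := congrArg Quiver.Path.length (Subsingleton.elim (p.comp q) e.toPath)
  rw [Quiver.Path.length_comp, Quiver.Path.length_toPath] at hpq
  have hp : p.length ≠ 0 := fun hp => hac.ne (p.eq_of_length_zero hp)
  have hq : q.length ≠ 0 := fun hq => hcb.ne (q.eq_of_length_zero hq)
  omega

theorem eq_or_exists_last {x b : V} (hxb : x ≤ b) : x = b ∨ ∃ y, x ≤ y ∧ Nonempty (y ⟶ b) := by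
  obtain ⟨p⟩ := h.le_iff.1 hxb
  cases p with
  | nil => exact Or.inl rfl
  | cons p e => exact Or.inr ⟨_, h.le_iff.2 ⟨p⟩, ⟨e⟩⟩

theorem eq_or_exists_first {x b : V} (hxb : x ≤ b) : x = b ∨ ∃ y, Nonempty (x ⟶ y) ∧ y ≤ b := by
  obtain ⟨p⟩ := h.le_iff.1 hxb
  clear hxb
  induction p with
  | nil => exact Or.inl rfl
  | @cons c b p e ih =>
    rcases ih with rfl | ⟨y, hy, hyc⟩
    · exact Or.inr ⟨b, ⟨e⟩, le_rfl⟩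
    · exact Or.inr ⟨y, hy, hyc.trans (h.le_of_hom e)⟩

/-- The paths from `a` to `b` through `x` and through `y` coincide; stripping last arrows reaches
one of the two vertices first. -/
theorem hasChainIntervals : HasChainIntervals V := by
  intro a b x y hax hxb hay hyb
  obtain ⟨p₁⟩ := h.le_iff.1 hax
  obtain ⟨p₂⟩ := h.le_iff.1 hxb
  obtain ⟨q₁⟩ := h.le_iff.1 hay
  obtain ⟨q₂⟩ := h.le_iff.1 hyb
  have := h.subsingleton a b
  have hpq := Subsingleton.elim (p₁.comp p₂) (q₁.comp q₂)
  clear hxb hyb this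
  induction p₂ with
  | nil => exact Or.inr (h.le_iff.2 ⟨q₂⟩)
  | @cons c b p₂ e ih =>
    cases q₂ with
    | nil => exact Or.inl (h.le_iff.2 ⟨p₂.cons e⟩)
    | @cons c' _ q₂ e' =>
      rw [Quiver.Path.comp_cons, Quiver.Path.comp_cons] at hpq
      obtain rfl := Quiver.Path.obj_eq_of_cons_eq_cons hpq
      exact ih q₂ (eq_of_heq (Quiver.Path.heq_of_cons_eq_cons hpq))

theorem mem_vertices_iff {a b x : V} (p : Quiver.Path a b) :
    x ∈ p.vertices ↔ a ≤ x ∧ x ≤ b := by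
  constructor
  · intro hx
    obtain ⟨p₁, p₂, -⟩ := p.exists_eq_comp_of_mem_vertices hx
    exact ⟨h.le_iff.2 ⟨p₁⟩, h.le_iff.2 ⟨p₂⟩⟩
  · rintro ⟨hax, hxb⟩
    obtain ⟨p₁⟩ := h.le_iff.1 hax
    obtain ⟨p₂⟩ := h.le_iff.1 hxb
    have := h.subsingleton a b
    rw [Subsingleton.elim p (p₁.comp p₂), Quiver.Path.vertices_comp, List.mem_append]
    exact Or.inr p₂.start_mem_vertices

end IsPathOrder

theorem eq_of_not_isBranching_out {x y z : V} (hx : ¬ IsBranching x) (e : x ⟶ y) (f : x ⟶ z) :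
    y = z := by
  have := not_nontrivial_iff_subsingleton.1 fun h => hx (Or.inl h)
  exact congrArg Sigma.fst (Subsingleton.elim (⟨y, e⟩ : Quiver.Star x) ⟨z, f⟩)

theorem eq_of_not_isBranching_in {x y z : V} (hx : ¬ IsBranching x) (e : y ⟶ x) (f : z ⟶ x) :
    y = z := by
  have := not_nontrivial_iff_subsingleton.1 fun h => hx (Or.inr h)
  exact congrArg Sigma.fst (Subsingleton.elim (⟨y, e⟩ : Quiver.Costar x) ⟨z, f⟩)

/-- A vertex that is not dropped, as a vertex of the armless subtree. -/
def Armless.mk (x : V) (hx : ¬ IsDropped x) : Armless V := ⟨x, hx⟩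

theorem IsBranching.not_isDropped {x : V} (hx : IsBranching x) : ¬ IsDropped x := by
  rintro (⟨a, b, p, hp, hxp, -⟩ | ⟨a, b, p, hp, hxp, -⟩)
  exacts [hp.2.2 x hxp hx, hp.2.2 x hxp hx]

namespace IsPathOrder

variable [PartialOrder V] (h : IsPathOrder V)

include h

/-- On an unbranched path such an `x` must be the last vertex, since the only possible next one is
`z`. The mirror statement follows; together they show that branching survives in the armless
subtree. -/
theorem not_isDropped_of_hom_isBranching {x z : V} (e : x ⟶ z) (hz : IsBranching z) :
    ¬ IsDropped x := by
  have key : ∀ {a b : V} (p : Quiver.Path a b), (∀ y ∈ p.vertices, ¬ IsBranching y) →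
      x ∈ p.vertices → x = b := by
    intro a b p hp hx
    have hx' := (h.mem_vertices_iff p).1 hx
    rcases h.eq_or_exists_first hx'.2 with hxb | ⟨y, ⟨f⟩, hyb⟩
    · exact hxb
    · obtain rfl := eq_of_not_isBranching_out (hp x hx) e f
      exact absurd hz (hp _ ((h.mem_vertices_iff p).2 ⟨hx'.1.trans (h.le_of_hom f), hyb⟩))
  rintro (⟨a, b, p, hp, hxp, hxb⟩ | ⟨a, b, p, hp, hxp, -⟩)
  · exact hxb (key p hp.2.2 hxp)
  · obtain rfl := key p hp.2.2 hxp
    exact (hp.1 z).elim e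

theorem not_isDropped_of_isBranching_hom {x z : V} (e : z ⟶ x) (hz : IsBranching z) :
    ¬ IsDropped x := by
  have key : ∀ {a b : V} (p : Quiver.Path a b), (∀ y ∈ p.vertices, ¬ IsBranching y) →
      x ∈ p.vertices → a = x := by
    intro a b p hp hx
    have hx' := (h.mem_vertices_iff p).1 hx
    rcases h.eq_or_exists_last hx'.1 with hxb | ⟨y, hay, ⟨f⟩⟩
    · exact hxb
    · obtain rfl := eq_of_not_isBranching_in (hp x hx) e f
      exact absurd hz (hp _ ((h.mem_vertices_iff p).2 ⟨hay, (h.le_of_hom f).trans hx'.2⟩))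
  rintro (⟨a, b, p, hp, hxp, -⟩ | ⟨a, b, p, hp, hxp, hxa⟩)
  · obtain rfl := key p hp.2.2 hxp
    exact (hp.1 z).elim e
  · exact hxa (key p hp.2.2 hxp).symm

/-- Each vertex of the arm has at most one arrow in and one out. Going backwards from the arm one
cannot leave it, as `a` is a source; going forwards one leaves it only through `b`. -/
theorem isLeftEnd_of_isLeftArm {a b : V} {p : Quiver.Path a b} (hp : IsLeftArm p) :
    IsLeftEnd (IsDropped (V := V)) b := by
  obtain ⟨hsource, ⟨c, ⟨e⟩, hc⟩, hbr⟩ := id hp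
  have hbr' : ∀ x, a ≤ x → x ≤ b → ¬ IsBranching x := fun x hax hxb =>
    hbr x ((h.mem_vertices_iff p).2 ⟨hax, hxb⟩)
  have hleast : ∀ {x} (_ : Quiver.Path a x), x ≤ b → ∀ y ≤ x, a ≤ y := by
    intro x q
    induction q with
    | nil =>
      intro _ y hy
      rcases h.eq_or_exists_last hy with rfl | ⟨z, -, ⟨f⟩⟩
      · exact le_rfl
      · exact (hsource z).elim f
    | @cons x' x q f ih =>
      intro hxb y hy
      rcases h.eq_or_exists_last hy with rfl | ⟨z, hyz, ⟨f'⟩⟩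
      · exact h.le_iff.2 ⟨q.cons f⟩
      · obtain rfl := eq_of_not_isBranching_in (hbr' x (h.le_iff.2 ⟨q.cons f⟩) hxb) f f'
        exact ih ((h.le_of_hom f).trans hxb) y hyz
  have hle : ∀ y ≤ b, a ≤ y := hleast p le_rfl
  refine ⟨h.not_isDropped_of_hom_isBranching e hc, ⟨a, hle⟩, fun y hy hyb =>
    Or.inl ⟨a, b, p, hp, (h.mem_vertices_iff p).2 ⟨hle y hy, hy⟩, hyb⟩, fun y z hyb hyz => ?_⟩
  obtain ⟨t⟩ := h.le_iff.1 hyz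
  clear hyz
  induction t with
  | nil => exact Or.inl hyb
  | @cons z' z t f ih =>
    rcases ih with hzb | hbz
    · rcases h.eq_or_exists_first hzb with rfl | ⟨z'', ⟨f'⟩, hz''⟩
      · exact Or.inr (h.le_of_hom f)
      · obtain rfl := eq_of_not_isBranching_out (hbr' z' (hle z' hzb) hzb) f f'
        exact Or.inl hz''
    · exact Or.inr (hbz.trans (h.le_of_hom f))

theorem isRightEnd_of_isRightArm {a b : V} {p : Quiver.Path a b} (hp : IsRightArm p) :
    IsRightEnd (IsDropped (V := V)) a := by
  obtain ⟨hsink, ⟨c, ⟨e⟩, hc⟩, hbr⟩ := id hp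
  have hbr' : ∀ x, a ≤ x → x ≤ b → ¬ IsBranching x := fun x hax hxb =>
    hbr x ((h.mem_vertices_iff p).2 ⟨hax, hxb⟩)
  have hle : ∀ y, a ≤ y → y ≤ b := by
    intro y hy
    obtain ⟨q⟩ := h.le_iff.1 hy
    clear hy
    induction q with
    | nil => exact h.le_iff.2 ⟨p⟩
    | @cons y' y q f ih =>
      rcases h.eq_or_exists_first ih with rfl | ⟨z, ⟨f'⟩, hz⟩
      · exact (hsink y).elim f
      · obtain rfl := eq_of_not_isBranching_out (hbr' y' (h.le_iff.2 ⟨q⟩) ih) f f'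
        exact hz
  have hcmp : ∀ {y z} (_ : Quiver.Path z y), a ≤ y → z ≤ a ∨ a ≤ z := by
    intro y z t
    induction t with
    | nil => exact Or.inr
    | @cons y' y t f ih =>
      intro hay
      rcases h.eq_or_exists_last hay with rfl | ⟨x, hax, ⟨f'⟩⟩
      · exact Or.inl (h.le_iff.2 ⟨t.cons f⟩)
      · obtain rfl := eq_of_not_isBranching_in (hbr' y hay (hle y hay)) f f'
        exact ih hax
  exact ⟨h.not_isDropped_of_isBranching_hom e hc, ⟨b, hle⟩, fun y hy hya =>
    Or.inr ⟨a, b, p, hp, (h.mem_vertices_iff p).2 ⟨hy, hle y hy⟩, hya⟩, fun y z hay hzy =>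
      (h.le_iff.1 hzy).elim fun t => hcmp t hay⟩

theorem isArmed : IsArmed (IsDropped (V := V)) := by
  rintro x (⟨a, b, p, hp, hxp, -⟩ | ⟨a, b, p, hp, hxp, -⟩)
  · exact Or.inl ⟨b, ((h.mem_vertices_iff p).1 hxp).2, h.isLeftEnd_of_isLeftArm hp⟩
  · exact Or.inr ⟨a, ((h.mem_vertices_iff p).1 hxp).1, h.isRightEnd_of_isRightArm hp⟩

/-- Convexity of the kept vertices: paths between them stay in the armless subtree. -/
theorem not_isDropped_of_between {a b x : V} (ha : ¬ IsDropped a) (hb : ¬ IsDropped b)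
    (hax : a ≤ x) (hxb : x ≤ b) : ¬ IsDropped x := by
  intro hx
  rcases h.isArmed x hx with ⟨e, hxe, he⟩ | ⟨c, hcx, hc⟩
  · obtain rfl := he.eq_of_le ha (hax.trans hxe)
    exact ha (le_antisymm hax hxe ▸ hx)
  · obtain rfl := hc.eq_of_le hb (hcx.trans hxb)
    exact hb (le_antisymm hxb hcx ▸ hx)

theorem exists_armless_path {a b : V} (p : Quiver.Path a b) (ha : ¬ IsDropped a)
    (hb : ¬ IsDropped b) :
    Nonempty (Quiver.Path (Armless.mk a ha) (Armless.mk b hb)) := by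
  induction p with
  | nil => exact ⟨.nil⟩
  | @cons x b p e ih =>
    have hx : ¬ IsDropped x := h.not_isDropped_of_between ha hb (h.le_iff.2 ⟨p⟩) (h.le_of_hom e)
    obtain ⟨q⟩ := ih hx
    exact ⟨q.cons (show Armless.mk x hx ⟶ Armless.mk b hb from e)⟩

end IsPathOrder

theorem length_mapPath_incl {a b : Armless V} (p : Quiver.Path a b) :
    ((Armless.incl V).mapPath p).length = p.length := by
  induction p with
  | nil => rfl
  | cons p e ih => rw [Prefunctor.mapPath_cons, Quiver.Path.length_cons, Quiver.Path.length_cons, ih]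

theorem mapPath_incl_injective {a b : Armless V} :
    Function.Injective fun p : Quiver.Path a b => (Armless.incl V).mapPath p := by
  intro p
  induction p with
  | nil =>
    intro q hq
    cases q with
    | nil => rfl
    | cons q e => exact absurd (congrArg Quiver.Path.length hq) (by simp [Prefunctor.mapPath_cons])
  | @cons x b p e ih =>
    intro q hq
    cases q with
    | nil => exact absurd (congrArg Quiver.Path.length hq) (by simp [Prefunctor.mapPath_cons])
    | @cons x' _ q e' =>
      simp only [Prefunctor.mapPath_cons] at hq
      obtain rfl : x = x' := Subtype.ext (Quiver.Path.obj_eq_of_cons_eq_cons hq)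
      rw [ih (eq_of_heq (Quiver.Path.heq_of_cons_eq_cons hq))]
      have he : e = e' := eq_of_heq (Quiver.Path.hom_heq_of_cons_eq_cons
        (e := (Armless.incl V).map e) (e' := (Armless.incl V).map e') hq)
      rw [he]

instance [PartialOrder V] : PartialOrder (Armless V) :=
  inferInstanceAs (PartialOrder {x : V // ¬ IsDropped x})

theorem IsPathOrder.armless [PartialOrder V] (h : IsPathOrder V) : IsPathOrder (Armless V) where
  le_iff {a b} := ⟨fun hab => (h.le_iff.1 (show a.1 ≤ b.1 from hab)).elim fun p =>
    h.exists_armless_path p a.2 b.2, fun ⟨p⟩ => show a.1 ≤ b.1 from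
      h.le_iff.2 ⟨(Armless.incl V).mapPath p⟩⟩
  subsingleton a b := ⟨fun p q => by
    have := h.subsingleton a.1 b.1
    exact mapPath_incl_injective (Subsingleton.elim (α := Quiver.Path a.1 b.1) _ _)⟩

end Tree

/-! ### The path basis of a bound quiver algebra -/

section BoundQuiver

variable {K : Type w} [Field K] {V : Type u} [Quiver.{v} V]

/-- The endpoints of the paths in a set of paths. -/
def endpointRel (R : Set (QPath V)) (a b : V) : Prop := ∃ p : Quiver.Path a b, ⟨a, b, p⟩ ∈ R

theorem PathAlgebra.of_mul_of_comp {a b c : V} (p : Quiver.Path a b) (q : Quiver.Path b c) :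
    of K ⟨b, c, q⟩ * of K ⟨a, b, p⟩ = of K ⟨a, c, p.comp q⟩ := by
  rw [of_mul_of, pathMul, dif_pos rfl]
  rfl

theorem PathAlgebra.of_mul_of_eq_zero {p q : QPath V} (h : p.1 ≠ q.2.1) :
    of K p * of K q = 0 := by
  rw [of_mul_of, pathMul, dif_neg h]

section Projection

variable [Fintype V]

variable (K) in
/-- The projection to the bound quiver algebra. -/
noncomputable def boundProj (R : Set (QPath V)) :
    PathAlgebra K V →ₐ[K] BoundQuiverAlgebra K R :=
  (relationIdeal K R).ringCon.mkₐ K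

theorem boundProj_surjective (R : Set (QPath V)) : Function.Surjective (boundProj K R) :=
  (relationIdeal K R).ringCon.mk'_surjective

theorem boundProj_eq_zero_iff (R : Set (QPath V)) (x : PathAlgebra K V) :
    boundProj K R x = 0 ↔ x ∈ relationIdeal K R := by
  rw [TwoSidedIdeal.mem_iff, ← RingCon.eq]
  rfl

end Projection

variable [PartialOrder V]

theorem IsPathOrder.lt_of_endpointRel (h : IsPathOrder V) {R : Set (QPath V)}
    (hR : R ⊆ zeroRelations V) (a b : V) (hab : endpointRel R a b) : a < b := by
  obtain ⟨p, hp⟩ := hab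
  have : 2 ≤ p.length := hR hp
  exact h.lt_of_length_pos p (by omega)

/-- An arrow is too short to contain a relation, so the arrows at a branching vertex always belong
to `N`. -/
theorem IsPathOrder.avoids_of_hom (h : IsPathOrder V) {R : Set (QPath V)}
    (hR : R ⊆ zeroRelations V) {a b : V} (e : a ⟶ b) : Avoids (endpointRel R) a b := by
  refine ⟨h.le_of_hom e, fun c d hcd hh => ?_⟩
  have hlt := h.lt_of_endpointRel hR c d hcd
  obtain ⟨p, hp⟩ := hcd
  have h2 : 2 ≤ p.length := hR hp
  have hcov := h.covBy_of_hom e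
  obtain rfl : c = a := (hcov.eq_or_eq hh.1 (hlt.le.trans hh.2)).resolve_right
    fun hc => (hlt.trans_le hh.2).ne hc
  obtain rfl : d = b := (hcov.eq_or_eq hlt.le hh.2).resolve_left hlt.ne'
  have := h.subsingleton c d
  rw [Subsingleton.elim p e.toPath, Quiver.Path.length_toPath] at h2
  omega

variable [Fintype V]

theorem boundProj_of_eq_zero (h : IsPathOrder V) {R : Set (QPath V)} {a b : V}
    (p : Quiver.Path a b) (hab : ¬ Avoids (endpointRel R) a b) :
    boundProj K R (PathAlgebra.of K ⟨a, b, p⟩) = 0 := by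
  obtain ⟨c, d, ⟨ρ, hρ⟩, hac, hdb⟩ : ∃ c d, endpointRel R c d ∧ a ≤ c ∧ d ≤ b := by
    by_contra! hcon
    exact hab ⟨h.le_iff.2 ⟨p⟩, fun c d hcd hh => hcon c d hcd hh.1 hh.2⟩
  obtain ⟨q⟩ := h.le_iff.1 hac
  obtain ⟨s⟩ := h.le_iff.1 hdb
  have := h.subsingleton a b
  have hρ0 : boundProj K R (PathAlgebra.of K ⟨c, d, ρ⟩) = 0 :=
    (boundProj_eq_zero_iff R _).2 (TwoSidedIdeal.subset_span ⟨_, hρ, rfl⟩)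
  rw [Subsingleton.elim p ((q.comp ρ).comp s), ← PathAlgebra.of_mul_of_comp,
    ← PathAlgebra.of_mul_of_comp, map_mul, map_mul, hρ0, zero_mul, mul_zero]

open Classical in
variable (K) in
/-- The coefficient of the path from `a` to `b` if this path avoids the relations, otherwise
zero. -/
noncomputable def pathCoeff (R : Set (QPath V)) (a b : V) : PathAlgebra K V →ₗ[K] K :=
  (PathAlgebra.basis K V).constr K fun p =>
    if a = p.1 ∧ b = p.2.1 ∧ Avoids (endpointRel R) a b then 1 else 0

open Classical in
theorem pathCoeff_of (R : Set (QPath V)) (a b : V) (p : QPath V) :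
    pathCoeff K R a b (PathAlgebra.of K p) =
      if a = p.1 ∧ b = p.2.1 ∧ Avoids (endpointRel R) a b then 1 else 0 := by
  rw [pathCoeff, PathAlgebra.of, Module.Basis.constr_basis]

theorem pathCoeff_mul_of_mul {R : Set (QPath V)} (h : IsPathOrder V) {ρ : QPath V} (hρ : ρ ∈ R)
    (a b : V) (x y : PathAlgebra K V) :
    pathCoeff K R a b (x * PathAlgebra.of K ρ * y) = 0 := by
  classical
  induction x using PathAlgebra.induction_on with
  | h0 => simp
  | hadd x x' hx hx' => rw [add_mul, add_mul, map_add, hx, hx', add_zero]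
  | hof k q =>
  induction y using PathAlgebra.induction_on with
  | h0 => simp
  | hadd y y' hy hy' => rw [mul_add, map_add, hy, hy', add_zero]
  | hof l s =>
  rw [smul_mul_assoc, smul_mul_assoc, mul_smul_comm, map_smul, map_smul]
  obtain ⟨c, d, ρ⟩ := ρ
  obtain ⟨d', b', q⟩ := q
  obtain ⟨a', c', s⟩ := s
  by_cases hd : d' = d
  · subst hd
    by_cases hc : c = c'
    · subst hc
      rw [PathAlgebra.of_mul_of_comp, PathAlgebra.of_mul_of_comp, pathCoeff_of, if_neg]
      · simp
      · rintro ⟨rfl, rfl, hav⟩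
        exact hav.2 c d' ⟨ρ, hρ⟩ ⟨h.le_iff.2 ⟨s⟩, h.le_iff.2 ⟨q⟩⟩
    · rw [PathAlgebra.of_mul_of_comp, PathAlgebra.of_mul_of_eq_zero hc]
      simp
  · rw [PathAlgebra.of_mul_of_eq_zero hd, zero_mul]
    simp

/-- The elements `z` such that the coefficient vanishes on all `x * z * y` form a two-sided ideal
containing the generators. -/
theorem pathCoeff_eq_zero {R : Set (QPath V)} (h : IsPathOrder V) (a b : V) {x : PathAlgebra K V}
    (hx : x ∈ relationIdeal K R) : pathCoeff K R a b x = 0 := by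
  let J : TwoSidedIdeal (PathAlgebra K V) := TwoSidedIdeal.mk'
    {z | ∀ x y, pathCoeff K R a b (x * z * y) = 0} (by simp)
    (fun {z z'} hz hz' x y => by rw [mul_add, add_mul, map_add, hz, hz', add_zero])
    (fun {z} hz x y => by rw [mul_neg, neg_mul, map_neg, hz, neg_zero])
    (fun {t z} hz x y => by rw [← mul_assoc, hz])
    (fun {z t} hz x y => by rw [← mul_assoc, mul_assoc, hz])
  have hJ : relationIdeal K R ≤ J := TwoSidedIdeal.span_le.2 (by
    rintro _ ⟨ρ, hρ, rfl⟩
    exact (TwoSidedIdeal.mem_mk' ..).2 fun x y => pathCoeff_mul_of_mul h hρ a b x y)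
  simpa using (TwoSidedIdeal.mem_mk' ..).1 (hJ hx) 1 1

open Classical in
/-- The basis of the bound quiver algebra given by the paths that avoid the relations. -/
noncomputable def boundPairBasis (h : IsPathOrder V) (R : Set (QPath V)) :
    PairBasis K (BoundQuiverAlgebra K R) (Avoids (endpointRel R)) := by
  let π := boundProj K R
  -- A linear section of the projection; the coefficients do not depend on it because `pathCoeff`
  -- vanishes on the ideal.
  let σ := (LinearMap.exists_rightInverse_of_surjective π.toLinearMap
    (LinearMap.range_eq_top.2 (boundProj_surjective R))).choose
  have hσ : ∀ x, π (σ x) = x := LinearMap.congr_fun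
    (LinearMap.exists_rightInverse_of_surjective π.toLinearMap
      (LinearMap.range_eq_top.2 (boundProj_surjective R))).choose_spec
  let E : V → V → BoundQuiverAlgebra K R := fun a b =>
    if hab : Nonempty (Quiver.Path a b) then π (PathAlgebra.of K ⟨a, b, hab.some⟩) else 0
  have hE : ∀ {a b} (p : Quiver.Path a b), E a b = π (PathAlgebra.of K ⟨a, b, p⟩) := by
    intro a b p
    have := h.subsingleton a b
    simp only [E, dif_pos (Nonempty.intro p)]
    rw [Subsingleton.elim p (Nonempty.intro p).some]
  have hE0 : ∀ {a b}, ¬ Avoids (endpointRel R) a b → E a b = 0 := by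
    intro a b hab
    by_cases hp : Nonempty (Quiver.Path a b)
    · rw [hE hp.some]
      exact boundProj_of_eq_zero h _ hab
    · exact dif_neg hp
  have hcoeff : ∀ a b x, pathCoeff K R a b (σ (π x)) = pathCoeff K R a b x := by
    intro a b x
    rw [← sub_eq_zero, ← map_sub]
    refine pathCoeff_eq_zero h a b ((boundProj_eq_zero_iff R _).1 ?_)
    rw [map_sub]
    exact sub_eq_zero.2 (hσ _)
  refine
  { E := E
    coeff := fun a b => pathCoeff K R a b ∘ₗ σ
    E_eq_zero := hE0
    coeff_E_self := ?_
    coeff_E_ne := ?_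
    sum_coeff := ?_
    mul_self := ?_
    mul_ne := ?_ }
  · intro a b hab
    obtain ⟨p⟩ := h.le_iff.1 hab.1
    rw [hE p, LinearMap.comp_apply, hcoeff, pathCoeff_of, if_pos ⟨rfl, rfl, hab⟩]
  · intro a b a' b' hne
    by_cases hp : Nonempty (Quiver.Path a' b')
    · rw [hE hp.some, LinearMap.comp_apply, hcoeff, pathCoeff_of,
        if_neg fun hh => hne ⟨hh.1, hh.2.1⟩]
    · rw [show E a' b' = 0 from dif_neg hp, map_zero]
  · intro x
    obtain ⟨x, rfl⟩ := boundProj_surjective R x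
    simp only [LinearMap.comp_apply]
    change ∑ a, ∑ b, pathCoeff K R a b (σ (π x)) • E a b = π x
    simp only [hcoeff]
    induction x using PathAlgebra.induction_on with
    | h0 => simp
    | hadd x y hx hy => simp only [map_add, add_smul, Finset.sum_add_distrib, hx, hy]
    | hof k p =>
      simp only [map_smul, smul_assoc, ← Finset.smul_sum]
      congr 1
      obtain ⟨a, b, p⟩ := p
      rw [Finset.sum_eq_single a, Finset.sum_eq_single b]
      · rw [← hE p, pathCoeff_of]
        by_cases hab : Avoids (endpointRel R) a b
        · rw [if_pos ⟨rfl, rfl, hab⟩, one_smul]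
        · rw [hE0 hab, smul_zero]
      · intro b' _ hb
        rw [pathCoeff_of, if_neg fun hh => hb hh.2.1, zero_smul]
      · simp
      · intro a' _ ha
        refine Finset.sum_eq_zero fun b' _ => ?_
        rw [pathCoeff_of, if_neg fun hh => ha hh.1, zero_smul]
      · simp
  · intro a b c hab hbc
    obtain ⟨p⟩ := h.le_iff.1 hab.1
    obtain ⟨q⟩ := h.le_iff.1 hbc.1
    rw [hE p, hE q, hE (p.comp q), ← map_mul, PathAlgebra.of_mul_of_comp]
  · intro a b c d hbc
    by_cases hp : Nonempty (Quiver.Path a b)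
    · by_cases hq : Nonempty (Quiver.Path c d)
      · rw [hE hp.some, hE hq.some, ← map_mul, PathAlgebra.of_mul_of_eq_zero (Ne.symm hbc),
          map_zero]
      · rw [show E c d = 0 from dif_neg hq, zero_mul]
    · rw [show E a b = 0 from dif_neg hp, mul_zero]

/-- The dominant dimension of a bound quiver algebra of a tree with a branching vertex. -/
theorem IsBranching.domDim_eq_ite (h : IsPathOrder V)
    (hs : ∀ a b : V, Subsingleton (a ⟶ b)) {z : V} (hz : IsBranching z) {R : Set (QPath V)}
    (hR : R ⊆ zeroRelations V) [Decidable (IsCovered (Avoids (endpointRel R)))] :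
    domDim (BoundQuiverAlgebra K R) = if IsCovered (Avoids (endpointRel R)) then 1 else 0 := by
  have hN := isConvexRel_avoids (h.lt_of_endpointRel hR)
  rcases hz with ⟨⟨x, e⟩, ⟨y, f⟩, hne⟩ | ⟨⟨x, e⟩, ⟨y, f⟩, hne⟩
  · have hxy : x ≠ y := by
      rintro rfl
      have := hs z x
      exact hne (by rw [Subsingleton.elim e f])
    convert (boundPairBasis (K := K) h R).domDim_eq_ite h.hasChainIntervals hN hxy
      (Or.inl ⟨h.covBy_of_hom e, h.covBy_of_hom f, h.avoids_of_hom hR e, h.avoids_of_hom hR f⟩)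
  · have hxy : x ≠ y := by
      rintro rfl
      have := hs x z
      exact hne (by rw [Subsingleton.elim e f])
    convert (boundPairBasis (K := K) h R).domDim_eq_ite h.hasChainIntervals hN hxy
      (Or.inr ⟨h.covBy_of_hom e, h.covBy_of_hom f, h.avoids_of_hom hR e, h.avoids_of_hom hR f⟩)

end BoundQuiver

/-! ### Relations and branching on the armless subtree -/

section Armless

variable {V : Type u} [Quiver.{v} V] [PartialOrder V]

/-- If the relations on the armless subtree are those of the tree that lie in it, then a path of
the armless subtree avoids them iff it avoids the relations on the tree. -/
theorem IsPathOrder.avoids_armless_iff (h : IsPathOrder V) {R : Set (QPath V)}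
    (hR : R ⊆ zeroRelations V) {R' : Set (QPath (Armless V))}
    (hRR : R ∩ Armless.path '' zeroRelations (Armless V) = Armless.path '' R') (a b : Armless V) :
    Avoids (endpointRel R') a b ↔ Avoids (endpointRel R) a.1 b.1 := by
  have hR'R : Armless.path '' R' ⊆ R := hRR ▸ Set.inter_subset_left
  constructor
  · rintro ⟨hab, hav⟩
    refine ⟨hab, fun c d ⟨ρ, hρ⟩ ⟨hac, hdb⟩ => ?_⟩
    have hcd : c ≤ d := h.le_iff.2 ⟨ρ⟩
    have hc := h.not_isDropped_of_between a.2 b.2 hac (hcd.trans hdb)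
    have hd := h.not_isDropped_of_between a.2 b.2 (hac.trans hcd) hdb
    obtain ⟨q⟩ := h.exists_armless_path ρ hc hd
    have hs := h.subsingleton c d
    have hq : (Armless.incl V).mapPath q = ρ := Subsingleton.elim (α := Quiver.Path c d) _ _
    have hmem : (⟨c, d, ρ⟩ : QPath V) ∈ Armless.path '' R' := by
      rw [← hRR]
      refine ⟨hρ, ⟨Armless.mk c hc, Armless.mk d hd, q⟩, ?_, ?_⟩
      · change 2 ≤ q.length
        rw [← length_mapPath_incl q, hq]
        exact hR hρ
      · exact congrArg (fun p : Quiver.Path c d => (⟨c, d, p⟩ : QPath V)) hq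
    obtain ⟨⟨c', d', q'⟩, hq', he⟩ := hmem
    have hc' : c'.1 = c := congrArg Sigma.fst he
    have hd' : d'.1 = d := congrArg (fun p : QPath V => p.2.1) he
    exact hav c' d' ⟨q', hq'⟩ ⟨show a.1 ≤ c'.1 from hc' ▸ hac, show d'.1 ≤ b.1 from hd' ▸ hdb⟩
  · rintro ⟨hab, hav⟩
    exact ⟨hab, fun c d ⟨ρ, hρ⟩ hh => hav c.1 d.1 ⟨_, hR'R ⟨_, hρ, rfl⟩⟩ hh⟩

theorem IsBranching.armless (h : IsPathOrder V) {z : V} (hz : IsBranching z) :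
    IsBranching (Armless.mk z hz.not_isDropped) := by
  rcases id hz with ⟨⟨x, e⟩, ⟨y, f⟩, hne⟩ | ⟨⟨x, e⟩, ⟨y, f⟩, hne⟩
  · refine Or.inl ⟨⟨Armless.mk x (h.not_isDropped_of_isBranching_hom e hz), e⟩,
      ⟨Armless.mk y (h.not_isDropped_of_isBranching_hom f hz), f⟩, fun he => hne ?_⟩
    exact congrArg (fun s : Quiver.Star (Armless.mk z hz.not_isDropped) =>
      (⟨s.1.1, s.2⟩ : Quiver.Star z)) he
  · refine Or.inr ⟨⟨Armless.mk x (h.not_isDropped_of_hom_isBranching e hz), e⟩,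
      ⟨Armless.mk y (h.not_isDropped_of_hom_isBranching f hz), f⟩, fun he => hne ?_⟩
    exact congrArg (fun s : Quiver.Costar (Armless.mk z hz.not_isDropped) =>
      (⟨s.1.1, s.2⟩ : Quiver.Costar z)) he

end Armless

end TreeAlgebra

/-! ### The comparison theorem -/

open TreeAlgebra

theorem mainTheorem8 {K : Type w} [Field K] {V : Type u} [Quiver.{v} V] [Fintype V]
    (hQ : TreeAlgebra.IsTree V) (hA : TreeAlgebra.HasArms V)
    (R : Set (TreeAlgebra.QPath V)) (hR : R ⊆ TreeAlgebra.zeroRelations V)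
    (R' : Set (TreeAlgebra.QPath (TreeAlgebra.Armless V)))
    (hR' : R' ⊆ TreeAlgebra.zeroRelations (TreeAlgebra.Armless V)) :
    (R = TreeAlgebra.Armless.path '' R' →
      TreeAlgebra.domDim (TreeAlgebra.BoundQuiverAlgebra K R) =
        TreeAlgebra.domDim (TreeAlgebra.BoundQuiverAlgebra K R')) ∧
    (TreeAlgebra.Armless.path '' R' ⊂ R →
      R ∩ TreeAlgebra.Armless.path '' TreeAlgebra.zeroRelations (TreeAlgebra.Armless V) =
        TreeAlgebra.Armless.path '' R' →
      TreeAlgebra.domDim (TreeAlgebra.BoundQuiverAlgebra K R') = 0 →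
      TreeAlgebra.domDim (TreeAlgebra.BoundQuiverAlgebra K R) = 0) := by
  classical
  let _ : PartialOrder V := pathOrder hQ.subsingleton_path
  have h : IsPathOrder V := ⟨Iff.rfl, hQ.subsingleton_path⟩
  -- An arm is attached to a branching vertex, which bounds both dominant dimensions by one.
  obtain ⟨z, hz⟩ : ∃ z : V, IsBranching z := by
    obtain ⟨a, b, p, -, hp | hp⟩ := hA
    exacts [hp.2.1.imp fun _ h => h.2, hp.2.1.imp fun _ h => h.2]
  have hdim : domDim (BoundQuiverAlgebra K R) =
      if IsCovered (Avoids (endpointRel R)) then 1 else 0 :=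
    hz.domDim_eq_ite h hQ.subsingleton_hom hR
  have hdim' : domDim (BoundQuiverAlgebra K R') =
      if IsCovered (Avoids (endpointRel R')) then 1 else 0 :=
    (hz.armless h).domDim_eq_ite h.armless (fun a b => hQ.subsingleton_hom a.1 b.1) hR'
  have hrestrict : R ∩ Armless.path '' zeroRelations (Armless V) = Armless.path '' R' →
      Avoids (endpointRel R') = fun a b : {x : V // ¬ IsDropped x} =>
        Avoids (endpointRel R) a.1 b.1 := fun hRR =>
    funext₂ fun a b => propext (h.avoids_armless_iff hR hRR a b)
  have hcov : R ∩ Armless.path '' zeroRelations (Armless V) = Armless.path '' R' →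
      IsCovered (Avoids (endpointRel R)) → IsCovered (Avoids (endpointRel R')) := fun hRR hC => by
    rw [hrestrict hRR]
    exact hC.restrict h.hasChainIntervals h.isArmed (isConvexRel_avoids (h.lt_of_endpointRel hR))
  refine ⟨fun hRR => ?_, fun _ hRR h0 => ?_⟩
  -- If the relations agree, the compatibility condition of (b) holds automatically.
  · have hRS : R ∩ Armless.path '' zeroRelations (Armless V) = Armless.path '' R' := by
      rw [← hRR, Set.inter_eq_left, hRR]
      exact Set.image_mono hR'
    have hiff : IsCovered (Avoids (endpointRel R)) ↔ IsCovered (Avoids (endpointRel R')) := by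
      refine ⟨hcov hRS, fun hC => IsCovered.extend h.isArmed (h.lt_of_endpointRel hR) ?_ ?_⟩
      · rintro c d ⟨ρ, hρ⟩
        rw [hRR] at hρ
        obtain ⟨⟨c', d', q⟩, -, he⟩ := hρ
        have hc' : c'.1 = c := congrArg Sigma.fst he
        have hd' : d'.1 = d := congrArg (fun p : QPath V => p.2.1) he
        exact ⟨hc' ▸ c'.2, hd' ▸ d'.2⟩
      · rw [hrestrict hRS] at hC
        exact hC
    rw [hdim, hdim']
    simp only [hiff]
  · rw [hdim, if_neg]
    intro hC
    rw [hdim', if_pos (hcov hRR hC)] at h0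
    exact one_ne_zero h0
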